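/- Let $N\ge 1$ and $\alpha>-1$. Let $\mathbb{B}_N$ be the open unit ball of $\mathbb{C}^N$, let $v$ be the Lebesgue measure on $\mathbb{B}_N$ normalized by $v(\mathbb{B}_N)=1$, and let $dv_\alpha(z)=c_\alpha(1-|z|^2)^\alpha\,dv(z)$ with $c_\alpha=\frac{\Gamma(N+\alpha+1)}{N!\,\Gamma(\alpha+1)}$. An Orlicz function is a strictly convex function $\psi:[0,\infty)\to[0,\infty)$ with $\psi(0)=0$, continuous at $0$, and such that $\psi(x)/x\to+\infty$ as $x\to\infty$. For such $\psi$, the weighted Bergman-Orlicz space $A^\psi_\alpha(\mathbb{B}_N)$ is the space of holomorphic functions $f$ on $\mathbb{B}_N$ such that $\int_{\mathbb{B}_N}\psi(|f|/C)\,dv_\alpha<\infty$ for some $C>0$, normed by the Luxemburg norm $\|f\|_\psi=\inf\{C>0:\int_{\mathbb{B}_N}\psi(|f|/C)\,dv_\alpha\le 1\}$. For $1<p<\infty$ and $\psi(x)=x^p$, this is the weighted Bergman space $A^p_\alpha(\mathbb{B}_N)$. One says that $\psi$ satisfies the $\Delta_2$-condition if there are $x_0>0$ and $K>1$ with $\psi(2x)\le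 K\psi(x)$ for all $x\ge x_0$, and the $\nabla_0$-condition if there are $x_0>0$ and $C\ge 1$ with $\frac{\psi(2x)}{\psi(x)}\le\frac{\psi(2Cy)}{\psi(y)}$ for all $x_0\le x\le y$. Let $\phi:\mathbb{B}_N\to\mathbb{B}_N$ be holomorphic, let $C_\phi f=f\circ\phi$, and let $\psi,\nu$ be Orlicz functions. "$C_\phi$ is bounded (compact) on $A$" means that $C_\phi$ maps $A$ into $A$ and is a bounded (compact) linear operator there. Assume that $\nu$ satisfies the $\Delta_2$-condition. Then: 1. If $C_\phi$ is bounded on $A^\nu_\alpha(\mathbb{B}_N)$, then $C_\phi$ is bounded on $A^\psi_\alpha(\mathbb{B}_N)$. In particular, this holds if $C_\phi$ is bounded on $A^p_\alpha(\mathbb{B}_N)$ for some $1<p<\infty$. 2. If $\psi$ satisfies the $\nabla_0$-condition and $C_\phi$ is compact on $A^\psi_\alpha(\mathbb{B}_N)$, then $C_\phi$ is compact on $A^\nu_\alpha(\mathbb{B}_N)$. In particular, $C_\phi$ is then compact on $A^p_\alpha(\mathbb{B}_N)$ for every $1<p<\infty$. -/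

import Mathlib

open MeasureTheory Set Filter Topology
open scoped ENNReal

noncomputable section

/-- An Orlicz function `ψ : ℝ₊ → ℝ₊`: strictly convex on `[0, ∞)`, nonnegative, vanishing at `0`,
continuous at `0`, and with `ψ x / x → ∞`. Only the values on `[0, ∞)` are ever used. -/
structure OrliczFunction where
  toFun : ℝ → ℝ
  nonneg' : ∀ x, 0 ≤ x → 0 ≤ toFun x
  strictConvexOn' : StrictConvexOn ℝ (Ici 0) toFun
  map_zero' : toFun 0 = 0
  continuousWithinAt_zero' : ContinuousWithinAt toFun (Ici 0) 0
  tendsto_div_atTop' : Tendsto (fun x => toFun x / x) atTop atTop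

namespace OrliczFunction

instance : CoeFun OrliczFunction (fun _ => ℝ → ℝ) := ⟨toFun⟩

/-- The power function `x ↦ x ^ p`, `1 < p < ∞`, as an Orlicz function. -/
def power (p : ℝ) (hp : 1 < p) : OrliczFunction where
  toFun x := x ^ p
  nonneg' x hx := Real.rpow_nonneg hx p
  strictConvexOn' := strictConvexOn_rpow hp
  map_zero' := Real.zero_rpow (by linarith)
  continuousWithinAt_zero' :=
    (Real.continuous_rpow_const (by linarith)).continuousWithinAt
  tendsto_div_atTop' := by
    refine (tendsto_rpow_atTop (sub_pos.2 hp)).congr' ?_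
    filter_upwards [eventually_gt_atTop 0] with x hx
    rw [Real.rpow_sub_one hx.ne']

/-- The `Δ₂`-condition. -/
def DeltaTwo (ψ : OrliczFunction) : Prop :=
  ∃ x₀ > 0, ∃ K > 1, ∀ x, x₀ ≤ x → ψ (2 * x) ≤ K * ψ x

/-- The `∇₀`-condition. -/
def NablaZero (ψ : OrliczFunction) : Prop :=
  ∃ x₀ > 0, ∃ C ≥ 1, ∀ x y, x₀ ≤ x → x ≤ y → ψ (2 * x) / ψ x ≤ ψ (2 * C * y) / ψ y

variable (ψ : OrliczFunction)

lemma scale_le {t x : ℝ} (ht : 0 ≤ t) (ht1 : t ≤ 1) (hx : 0 ≤ x) : ψ (t * x) ≤ t * ψ x := by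
  have h := ψ.strictConvexOn'.convexOn.2 (mem_Ici.2 hx) (mem_Ici.2 le_rfl) ht
    (sub_nonneg.2 ht1) (by ring)
  simpa [ψ.map_zero'] using h

lemma pos {x : ℝ} (hx : 0 < x) : 0 < ψ x := by
  have h := ψ.strictConvexOn'.2 (mem_Ici.2 hx.le) (mem_Ici.2 le_rfl) hx.ne'
    (by norm_num : (0 : ℝ) < 1 / 2) (by norm_num : (0 : ℝ) < 1 / 2) (by norm_num)
  simp only [smul_eq_mul, ψ.map_zero', mul_zero, add_zero] at h
  have h2 := ψ.nonneg' (1 / 2 * x) (by positivity)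
  linarith

lemma monotoneOn : MonotoneOn ψ (Ici 0) := by
  intro x hx y hy hxy
  rcases eq_or_lt_of_le (mem_Ici.1 hy) with h | h
  · have hx0 : x = y := le_antisymm hxy (h ▸ hx)
    rw [hx0]
  · have h1 := ψ.scale_le (t := x / y) (div_nonneg hx hy) (div_le_one_of_le₀ hxy hy) hy
    rw [div_mul_cancel₀ _ h.ne'] at h1
    exact h1.trans (mul_le_of_le_one_left (ψ.nonneg' y hy) (div_le_one_of_le₀ hxy hy))

lemma measurable_max : Measurable (fun x : ℝ => ψ (max x 0)) := by
  refine Monotone.measurable fun x y hxy => ψ.monotoneOn (mem_Ici.2 (le_max_right _ _))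
    (mem_Ici.2 (le_max_right _ _)) ?_
  exact max_le_max_right 0 hxy

end OrliczFunction

section Luxemburg

variable {Ω : Type*} [MeasurableSpace Ω]

/-- The modular `∫ ψ(|f| / C) dμ`, with values in `[0, ∞]`. -/
def orliczModular (ψ : OrliczFunction) (μ : Measure Ω) (f : Ω → ℂ) (C : ℝ) : ℝ≥0∞ :=
  ∫⁻ z, ENNReal.ofReal (ψ (‖f z‖ / C)) ∂μ

/-- Membership in the Orlicz space `L^ψ(μ)`. -/
def MemOrlicz (ψ : OrliczFunction) (μ : Measure Ω) (f : Ω → ℂ) : Prop :=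
  AEStronglyMeasurable f μ ∧ ∃ C > 0, orliczModular ψ μ f C < ∞

/-- The Luxemburg norm `inf {C > 0 : ∫ ψ(|f| / C) dμ ≤ 1}`. -/
def luxemburgNorm (ψ : OrliczFunction) (μ : Measure Ω) (f : Ω → ℂ) : ℝ :=
  sInf {C : ℝ | 0 < C ∧ orliczModular ψ μ f C ≤ 1}

variable {ψ : OrliczFunction} {μ : Measure Ω} {f g : Ω → ℂ}

lemma luxemburgNorm_nonneg : 0 ≤ luxemburgNorm ψ μ f :=
  Real.sInf_nonneg fun _ h => h.1.le

lemma luxemburg_bddBelow : BddBelow {C : ℝ | 0 < C ∧ orliczModular ψ μ f C ≤ 1} :=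
  ⟨0, fun _ h => h.1.le⟩

/-- `∫ ψ(|f| / (C / t)) ≤ t ∫ ψ(|f| / C)` for `0 < t ≤ 1`. -/
lemma orliczModular_div_le {C t : ℝ} (hC : 0 < C) (ht : 0 < t) (ht1 : t ≤ 1) :
    orliczModular ψ μ f (C / t) ≤ ENNReal.ofReal t * orliczModular ψ μ f C := by
  unfold orliczModular
  rw [← lintegral_const_mul' _ _ ENNReal.ofReal_ne_top]
  refine lintegral_mono fun z => ?_
  rw [← ENNReal.ofReal_mul ht.le]
  refine ENNReal.ofReal_le_ofReal ?_
  have h : ‖f z‖ / (C / t) = t * (‖f z‖ / C) := by field_simp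
  rw [h]
  exact ψ.scale_le ht.le ht1 (by positivity)

lemma orliczModular_anti {C D : ℝ} (hC : 0 < C) (hCD : C ≤ D) :
    orliczModular ψ μ f D ≤ orliczModular ψ μ f C :=
  lintegral_mono fun _ => ENNReal.ofReal_le_ofReal <|
    ψ.monotoneOn (div_nonneg (norm_nonneg _) (hC.le.trans hCD))
      (div_nonneg (norm_nonneg _) hC.le) (div_le_div_of_nonneg_left (norm_nonneg _) hC hCD)

lemma orliczModular_add_le (hf : AEStronglyMeasurable f μ) {C D : ℝ} (hC : 0 < C) (hD : 0 < D) :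
    orliczModular ψ μ (f + g) (C + D) ≤ ENNReal.ofReal (C / (C + D)) * orliczModular ψ μ f C
      + ENNReal.ofReal (D / (C + D)) * orliczModular ψ μ g D := by
  have hm : AEMeasurable (fun z => ENNReal.ofReal (ψ (‖f z‖ / C))) μ := by
    have h : (fun z => ENNReal.ofReal (ψ (‖f z‖ / C)))
        = fun z => ENNReal.ofReal (ψ (max (‖f z‖ / C) 0)) := by
      funext z
      rw [max_eq_left (by positivity)]
    rw [h]
    exact (ψ.measurable_max.comp_aemeasurable (hf.norm.aemeasurable.div_const C)).ennreal_ofReal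
  unfold orliczModular
  rw [← lintegral_const_mul' _ _ ENNReal.ofReal_ne_top,
    ← lintegral_const_mul' _ _ ENNReal.ofReal_ne_top, ← lintegral_add_left' (hm.const_mul _)]
  refine lintegral_mono fun z => ?_
  rw [← ENNReal.ofReal_mul (by positivity), ← ENNReal.ofReal_mul (by positivity),
    ← ENNReal.ofReal_add (mul_nonneg (by positivity) (ψ.nonneg' _ (by positivity)))
      (mul_nonneg (by positivity) (ψ.nonneg' _ (by positivity)))]
  refine ENNReal.ofReal_le_ofReal ?_
  have h1 : ψ (‖(f + g) z‖ / (C + D)) ≤ ψ ((‖f z‖ + ‖g z‖) / (C + D)) := by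
    refine ψ.monotoneOn (mem_Ici.2 (by positivity)) (mem_Ici.2 (by positivity)) ?_
    gcongr
    exact norm_add_le _ _
  refine h1.trans ?_
  have h2 := ψ.strictConvexOn'.convexOn.2
    (mem_Ici.2 (by positivity : 0 ≤ ‖f z‖ / C)) (mem_Ici.2 (by positivity : 0 ≤ ‖g z‖ / D))
    (by positivity : 0 ≤ C / (C + D)) (by positivity : 0 ≤ D / (C + D)) (by field_simp)
  have h3 : (C / (C + D)) • (‖f z‖ / C) + (D / (C + D)) • (‖g z‖ / D)
      = (‖f z‖ + ‖g z‖) / (C + D) := by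
    simp only [smul_eq_mul]
    field_simp
  rw [h3] at h2
  exact h2

lemma orliczModular_smul {c : ℂ} (hc : c ≠ 0) (C : ℝ) :
    orliczModular ψ μ (c • f) (‖c‖ * C) = orliczModular ψ μ f C := by
  unfold orliczModular
  congr 1
  funext z
  rw [Pi.smul_apply, norm_smul, mul_div_mul_left _ _ (norm_ne_zero_iff.2 hc)]

lemma orliczModular_zero (C : ℝ) : orliczModular ψ μ 0 C = 0 := by
  simp [orliczModular, ψ.map_zero']

lemma luxemburgNorm_zero : luxemburgNorm ψ μ 0 = 0 := by
  refine le_antisymm (le_of_forall_pos_le_add fun ε hε => ?_) luxemburgNorm_nonneg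
  rw [zero_add]
  exact csInf_le luxemburg_bddBelow ⟨hε, by simp [orliczModular_zero]⟩

lemma MemOrlicz.zero : MemOrlicz ψ μ (0 : Ω → ℂ) :=
  ⟨aestronglyMeasurable_zero, 1, one_pos, by simp [orliczModular_zero]⟩

lemma MemOrlicz.add (hf : MemOrlicz ψ μ f) (hg : MemOrlicz ψ μ g) : MemOrlicz ψ μ (f + g) := by
  obtain ⟨hfm, C, hC, hfC⟩ := hf
  obtain ⟨hgm, D, hD, hgD⟩ := hg
  refine ⟨hfm.add hgm, C + D, add_pos hC hD, (orliczModular_add_le hfm hC hD).trans_lt ?_⟩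
  exact ENNReal.add_lt_top.2 ⟨ENNReal.mul_lt_top ENNReal.ofReal_lt_top hfC,
    ENNReal.mul_lt_top ENNReal.ofReal_lt_top hgD⟩

lemma MemOrlicz.smul (c : ℂ) (hf : MemOrlicz ψ μ f) : MemOrlicz ψ μ (c • f) := by
  rcases eq_or_ne c 0 with rfl | hc
  · rw [zero_smul]
    exact MemOrlicz.zero
  obtain ⟨hfm, C, hC, hfC⟩ := hf
  exact ⟨hfm.const_smul c, ‖c‖ * C, mul_pos (norm_pos_iff.2 hc) hC, by rwa [orliczModular_smul hc]⟩

lemma MemOrlicz.nonempty (hf : MemOrlicz ψ μ f) :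
    {C : ℝ | 0 < C ∧ orliczModular ψ μ f C ≤ 1}.Nonempty := by
  obtain ⟨-, C, hC, hfC⟩ := hf
  set M := (orliczModular ψ μ f C).toReal with hM
  have hM0 : 0 ≤ M := ENNReal.toReal_nonneg
  refine ⟨C / (1 / (M + 1)), by positivity, ?_⟩
  refine (orliczModular_div_le hC (t := 1 / (M + 1)) (by positivity)
    (by rw [div_le_one (by positivity)]; linarith)).trans ?_
  rw [← ENNReal.ofReal_toReal hfC.ne, ← ENNReal.ofReal_mul (by positivity)]
  refine ENNReal.ofReal_le_one.2 ?_
  rw [← hM, one_div_mul_eq_div, div_le_one (by positivity)]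
  linarith

lemma luxemburgNorm_add_le (hf : MemOrlicz ψ μ f) (hg : MemOrlicz ψ μ g) :
    luxemburgNorm ψ μ (f + g) ≤ luxemburgNorm ψ μ f + luxemburgNorm ψ μ g := by
  refine le_of_forall_pos_le_add fun ε hε => ?_
  obtain ⟨C, ⟨hC, hfC⟩, hC'⟩ := exists_lt_of_csInf_lt hf.nonempty
    (show sInf _ < luxemburgNorm ψ μ f + ε / 2 from lt_add_of_pos_right _ (half_pos hε))
  obtain ⟨D, ⟨hD, hgD⟩, hD'⟩ := exists_lt_of_csInf_lt hg.nonempty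
    (show sInf _ < luxemburgNorm ψ μ g + ε / 2 from lt_add_of_pos_right _ (half_pos hε))
  have h : luxemburgNorm ψ μ (f + g) ≤ C + D := by
    refine csInf_le luxemburg_bddBelow ⟨add_pos hC hD, ?_⟩
    refine (orliczModular_add_le hf.1 hC hD).trans ?_
    refine (add_le_add (mul_le_of_le_one_right' hfC) (mul_le_of_le_one_right' hgD)).trans ?_
    rw [← ENNReal.ofReal_add (by positivity) (by positivity), ← add_div,
      div_self (by positivity), ENNReal.ofReal_one]
  linarith

lemma luxemburgNorm_smul_le (c : ℂ) (hf : MemOrlicz ψ μ f) :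
    luxemburgNorm ψ μ (c • f) ≤ ‖c‖ * luxemburgNorm ψ μ f := by
  rcases eq_or_ne c 0 with rfl | hc
  · simp [luxemburgNorm_zero]
  have hc0 := norm_pos_iff.2 hc
  rw [← div_le_iff₀' hc0]
  refine le_csInf hf.nonempty fun C hC => ?_
  rw [div_le_iff₀' hc0]
  exact csInf_le luxemburg_bddBelow ⟨mul_pos hc0 hC.1, by rw [orliczModular_smul hc]; exact hC.2⟩

lemma luxemburgNorm_smul (c : ℂ) (hf : MemOrlicz ψ μ f) :
    luxemburgNorm ψ μ (c • f) = ‖c‖ * luxemburgNorm ψ μ f := by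
  refine le_antisymm (luxemburgNorm_smul_le c hf) ?_
  rcases eq_or_ne c 0 with rfl | hc
  · simp [luxemburgNorm_zero]
  have h := luxemburgNorm_smul_le c⁻¹ (hf.smul c)
  rw [inv_smul_smul₀ hc, norm_inv] at h
  rwa [← le_inv_mul_iff₀ (norm_pos_iff.2 hc)]

lemma ae_eq_zero_of_luxemburgNorm (hf : MemOrlicz ψ μ f) (h0 : luxemburgNorm ψ μ f = 0) :
    f =ᵐ[μ] 0 := by
  have hle : ∀ t : ℝ, 0 < t → t ≤ 1 → orliczModular ψ μ f 1 ≤ ENNReal.ofReal t := by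
    intro t ht ht1
    obtain ⟨C, ⟨hC, hfC⟩, hCt⟩ := exists_lt_of_csInf_lt hf.nonempty
      (show sInf _ < t from lt_of_eq_of_lt h0 ht)
    have h1 := orliczModular_div_le (ψ := ψ) (μ := μ) (f := f) ht ht ht1
    rw [div_self ht.ne'] at h1
    exact h1.trans (mul_le_of_le_one_right' ((orliczModular_anti hC hCt.le).trans hfC))
  have hz : orliczModular ψ μ f 1 = 0 := by
    refine le_antisymm (ENNReal.le_of_forall_pos_le_add fun ε hε _ => ?_) bot_le
    rw [zero_add]
    refine (hle (min ε 1) (lt_min hε one_pos) (min_le_right _ _)).trans ?_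
    refine (ENNReal.ofReal_le_ofReal (min_le_left _ _)).trans ?_
    simp
  have hm : AEMeasurable (fun z => ENNReal.ofReal (ψ (‖f z‖ / 1))) μ := by
    have h : (fun z => ENNReal.ofReal (ψ (‖f z‖ / 1)))
        = fun z => ENNReal.ofReal (ψ (max (‖f z‖) 0)) := by
      funext z
      rw [max_eq_left (by positivity), div_one]
    rw [h]
    exact (ψ.measurable_max.comp_aemeasurable hf.1.norm.aemeasurable).ennreal_ofReal
  filter_upwards [(lintegral_eq_zero_iff' hm).1 hz] with z hz
  by_contra hne
  have hp := ψ.pos (norm_pos_iff.2 hne)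
  simp only [div_one, Pi.zero_apply, ENNReal.ofReal_eq_zero] at hz
  linarith

end Luxemburg

/-- The open unit ball `𝔹_N` of `ℂ^N`, as a set and (by coercion) as a type. -/
abbrev cBall (N : ℕ) : Set (EuclideanSpace ℂ (Fin N)) := Metric.ball 0 1

/-- A map on `𝔹_N` is holomorphic if it is the restriction of a map that is complex differentiable
on the open set `𝔹_N ⊆ ℂ^N`. -/
def HolomorphicOnBall {N : ℕ} {G : Type*} [NormedAddCommGroup G] [NormedSpace ℂ G]
    (f : cBall N → G) : Prop :=
  ∃ F : EuclideanSpace ℂ (Fin N) → G, DifferentiableOn ℂ F (cBall N) ∧ ∀ z : cBall N, F z = f z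

lemma HolomorphicOnBall.continuous {N : ℕ} {G : Type*} [NormedAddCommGroup G] [NormedSpace ℂ G]
    {f : cBall N → G} (hf : HolomorphicOnBall f) : Continuous f := by
  obtain ⟨F, hF, hFf⟩ := hf
  have h := continuousOn_iff_continuous_domRestrict.1 hF.continuousOn
  exact h.congr hFf

/-- Lebesgue measure of `ℂ^N = ℝ^{2N}`, as a measure on `𝔹_N`. -/
def ballLebesgue (N : ℕ) : Measure (cBall N) :=
  Measure.comap Subtype.val (volume : Measure (EuclideanSpace ℂ (Fin N)))

/-- The normalized volume measure `v` on `𝔹_N`, so that `v(𝔹_N) = 1`. -/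
def ballVolume (N : ℕ) : Measure (cBall N) :=
  (ballLebesgue N univ)⁻¹ • ballLebesgue N

/-- The constant `c_α = Γ(N + α + 1) / (N! Γ(α + 1))`. -/
def weightConst (N : ℕ) (α : ℝ) : ℝ :=
  Real.Gamma (N + α + 1) / (N.factorial * Real.Gamma (α + 1))

/-- The weighted measure `dv_α(z) = c_α (1 - |z|²)^α dv(z)` on `𝔹_N`. -/
def weightedVolume (N : ℕ) (α : ℝ) : Measure (cBall N) :=
  (ballVolume N).withDensity
    fun z => ENNReal.ofReal (weightConst N α * (1 - ‖(z : EuclideanSpace ℂ (Fin N))‖ ^ 2) ^ α)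

lemma ballLebesgue_univ (N : ℕ) : ballLebesgue N univ = volume (cBall N) := by
  rw [ballLebesgue, comap_subtype_coe_apply measurableSet_ball, image_univ, Subtype.range_coe]

lemma ballLebesgue_absolutelyContinuous_weightedVolume (N : ℕ) {α : ℝ} (hα : -1 < α) :
    ballLebesgue N ≪ weightedVolume N α := by
  have hvol : ballLebesgue N univ ≠ ∞ := by
    rw [ballLebesgue_univ]
    exact measure_ball_lt_top.ne
  have h1 : ballLebesgue N ≪ ballVolume N :=
    Measure.absolutelyContinuous_smul (ENNReal.inv_ne_zero.2 hvol)
  refine h1.trans (withDensity_absolutelyContinuous' ?_ ?_)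
  · refine Measurable.aemeasurable ?_
    fun_prop
  · refine Eventually.of_forall fun z => ?_
    have hz : ‖(z : EuclideanSpace ℂ (Fin N))‖ < 1 := mem_ball_zero_iff.1 z.2
    have hz2 : 0 < 1 - ‖(z : EuclideanSpace ℂ (Fin N))‖ ^ 2 := by
      nlinarith [norm_nonneg (z : EuclideanSpace ℂ (Fin N))]
    have hN : (0 : ℝ) ≤ N := N.cast_nonneg
    have hc : 0 < weightConst N α :=
      div_pos (Real.Gamma_pos_of_pos (by linarith))
        (mul_pos (by exact_mod_cast N.factorial_pos) (Real.Gamma_pos_of_pos (by linarith)))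
    exact (ENNReal.ofReal_pos.2 (mul_pos hc (Real.rpow_pos_of_pos hz2 α))).ne'

lemma isOpenPosMeasure_weightedVolume (N : ℕ) {α : ℝ} (hα : -1 < α) :
    (weightedVolume N α).IsOpenPosMeasure := by
  have h : (ballLebesgue N).IsOpenPosMeasure :=
    Measure.IsOpenPosMeasure.comap volume Metric.isOpen_ball.isOpenEmbedding_subtypeVal
  exact (ballLebesgue_absolutelyContinuous_weightedVolume N hα).isOpenPosMeasure

/-- The vector space `H(𝔹_N) ∩ L^ψ(v_α)` of functions on `𝔹_N`. -/
def bergmanOrliczSubmodule (N : ℕ) (α : ℝ) (ψ : OrliczFunction) :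
    Submodule ℂ (cBall N → ℂ) where
  carrier := {f | HolomorphicOnBall f ∧ MemOrlicz ψ (weightedVolume N α) f}
  zero_mem' := ⟨⟨0, differentiableOn_const 0, fun _ => rfl⟩, MemOrlicz.zero⟩
  add_mem' := by
    rintro f g ⟨⟨F, hF, hFf⟩, hf⟩ ⟨⟨G, hG, hGg⟩, hg⟩
    exact ⟨⟨F + G, hF.add hG, fun z => by simp [hFf, hGg]⟩, hf.add hg⟩
  smul_mem' := by
    rintro c f ⟨⟨F, hF, hFf⟩, hf⟩
    exact ⟨⟨c • F, hF.const_smul c, fun z => by simp [hFf]⟩, hf.smul c⟩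

/-- The weighted Bergman-Orlicz space `A^ψ_α(𝔹_N)`. It is a type of its own, so that its topology is
the one of the Luxemburg norm and not the topology of pointwise convergence. -/
def BergmanOrlicz (N : ℕ) (α : ℝ) (ψ : OrliczFunction) : Type :=
  bergmanOrliczSubmodule N α ψ

namespace BergmanOrlicz

variable {N : ℕ} {α : ℝ} {ψ : OrliczFunction}

instance : AddCommGroup (BergmanOrlicz N α ψ) :=
  inferInstanceAs (AddCommGroup (bergmanOrliczSubmodule N α ψ))

instance : Module ℂ (BergmanOrlicz N α ψ) :=
  inferInstanceAs (Module ℂ (bergmanOrliczSubmodule N α ψ))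

instance : CoeFun (BergmanOrlicz N α ψ) (fun _ => cBall N → ℂ) := ⟨fun f => f.1⟩

instance : Norm (BergmanOrlicz N α ψ) :=
  ⟨fun f => luxemburgNorm ψ (weightedVolume N α) f⟩

lemma core (hα : -1 < α) : NormedSpace.Core ℂ (BergmanOrlicz N α ψ) where
  norm_nonneg _ := luxemburgNorm_nonneg
  norm_smul c f := luxemburgNorm_smul c f.2.2
  norm_triangle f g := luxemburgNorm_add_le f.2.2 g.2.2
  norm_eq_zero_iff f := by
    refine ⟨fun h => ?_, fun h => ?_⟩
    · have hae := ae_eq_zero_of_luxemburgNorm f.2.2 h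
      have := isOpenPosMeasure_weightedVolume N hα
      exact Subtype.ext ((f.2.1.continuous.ae_eq_iff_eq _ continuous_const).1 hae)
    · subst h
      exact luxemburgNorm_zero

instance [hα : Fact (-1 < α)] : NormedAddCommGroup (BergmanOrlicz N α ψ) :=
  NormedAddCommGroup.ofCore (core hα.out)

instance [hα : Fact (-1 < α)] : NormedSpace ℂ (BergmanOrlicz N α ψ) :=
  NormedSpace.ofCore (core hα.out)

end BergmanOrlicz

/-- The composition operator `C_φ f = f ∘ φ` maps `A^ψ_α(𝔹_N)` into itself and is bounded there. -/
def CompositionBounded {N : ℕ} (α : ℝ) [Fact (-1 < α)] (ψ : OrliczFunction)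
    (φ : cBall N → cBall N) : Prop :=
  ∃ T : BergmanOrlicz N α ψ →L[ℂ] BergmanOrlicz N α ψ, ∀ f z, T f z = f (φ z)

/-- The composition operator `C_φ f = f ∘ φ` maps `A^ψ_α(𝔹_N)` into itself and is compact there. -/
def CompositionCompact {N : ℕ} (α : ℝ) [Fact (-1 < α)] (ψ : OrliczFunction)
    (φ : cBall N → cBall N) : Prop :=
  ∃ T : BergmanOrlicz N α ψ →L[ℂ] BergmanOrlicz N α ψ,
    (∀ f z, T f z = f (φ z)) ∧ IsCompactOperator T

end

/-! Everything passes through the image measure `μ` of `v_α` under `φ`, and through conditions on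
`μ` in which no Orlicz function occurs. It is a Carleson measure if `μ (bergmanRegion z) ≤ κ (1 -
|z|²)^(N+1+α)` for all `z`, and a vanishing one if `κ` can be made arbitrarily small for `z` close
to the sphere.

From measures to operators: Jensen's inequality on circles gives `ψ(|f|)` a sub-mean value property
over Bergman regions, with a constant independent of `ψ`. By Tonelli, a Carleson measure satisfies
`∫ ψ(|f|/R) dμ ≤ C κ ∫ ψ(|f|/R) dv_α` for every `ψ` at once (`exists_orliczModular_le_of_carleson`),
and convexity turns this into a norm bound for `C_φ`. If `μ` is vanishing Carleson and `ν` is `Δ₂`,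
take a bounded sequence tending to zero pointwise (Montel): near the sphere `μ` contributes little,
and elsewhere dominated convergence applies. `Δ₂` keeps the modulars bounded at every scale `R`.

From operators to measures: powers of `(1 - |a|²) / (1 - ⟨z, a⟩)`, scaled by `M` with `ψ(M) = (1 -
|a|²)^(-(N+1+α))`, have bounded norm and are at least `M / 8^m` on `bergmanRegion a`. Chebyshev's
inequality gives `ψ(M / (8^m R)) μ(bergmanRegion a) ≤ 1` as soon as `R` exceeds the norm of the
image. For a bounded operator `R` is fixed and `Δ₂` removes the constant. For a compact one the
images tend to zero in norm along a subsequence as `a` approaches the sphere, so `R` can be small,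
and `ψ(A M) ≥ A ψ(M)` yields the vanishing condition. -/

namespace OrliczFunction

/-! ### Growth of Orlicz functions -/

variable (ψ : OrliczFunction)

lemma continuousOn : ContinuousOn ψ (Ici 0) := by
  intro x hx
  rcases eq_or_lt_of_le (mem_Ici.1 hx) with rfl | h
  · exact ψ.continuousWithinAt_zero'
  · have h1 := ψ.strictConvexOn'.convexOn.continuousOn_interior
    rw [interior_Ici] at h1
    exact (h1.continuousAt (Ioi_mem_nhds h)).continuousWithinAt

lemma le_scale {A x : ℝ} (hA : 1 ≤ A) (hx : 0 ≤ x) : A * ψ x ≤ ψ (A * x) := by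
  have hA0 : 0 < A := by linarith
  have h := ψ.scale_le (t := A⁻¹) (x := A * x) (by positivity) (inv_le_one_of_one_le₀ hA)
    (by positivity)
  rw [inv_mul_cancel_left₀ hA0.ne'] at h
  rwa [le_inv_mul_iff₀ hA0] at h

lemma tendsto_atTop : Tendsto ψ atTop atTop := by
  refine tendsto_atTop_mono' _ ?_ (tendsto_id.atTop_mul_const (ψ.pos one_pos))
  filter_upwards [eventually_ge_atTop 1] with x hx
  simpa using ψ.le_scale hx zero_le_one

lemma exists_eq {y : ℝ} (hy : 0 ≤ y) : ∃ x, 0 ≤ x ∧ ψ x = y := by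
  obtain ⟨b, hb, hb0⟩ := ((ψ.tendsto_atTop.eventually_ge_atTop y).and
    (eventually_ge_atTop (0 : ℝ))).exists
  have h := intermediate_value_Icc hb0 (ψ.continuousOn.mono Icc_subset_Ici_self)
  rw [ψ.map_zero'] at h
  obtain ⟨x, hx, rfl⟩ := h ⟨hy, hb⟩
  exact ⟨x, hx.1, rfl⟩

variable {ψ}

/-- Iterating `Δ₂` absorbs any dilation into a factor `K`; the additive `L` takes care of small
arguments, where `Δ₂` says nothing. On a finite measure space `L` is harmless, so this is the form
in which `Δ₂` is applied. -/
lemma DeltaTwo.exists_le_mul_add (h : ψ.DeltaTwo) {t : ℝ} (ht : 0 < t) :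
    ∃ K ≥ 0, ∃ L ≥ 0, ∀ x, 0 ≤ x → ψ x ≤ K * ψ (t * x) + L := by
  obtain ⟨x₀, hx₀, K, hK, h⟩ := h
  obtain ⟨k, hk⟩ := exists_pow_lt_of_lt_one ht (by norm_num : (1 / 2 : ℝ) < 1)
  have key : ∀ j : ℕ, ∀ x, x₀ ≤ x → ψ (2 ^ j * x) ≤ K ^ j * ψ x := by
    intro j
    induction j with
    | zero => intro x _; simp
    | succ j ih =>
      intro x hx
      have h1 : x₀ ≤ 2 ^ j * x :=
        hx.trans (le_mul_of_one_le_left (hx₀.le.trans hx) (one_le_pow₀ (by norm_num)))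
      calc ψ (2 ^ (j + 1) * x) = ψ (2 * (2 ^ j * x)) := by ring_nf
        _ ≤ K * ψ (2 ^ j * x) := h _ h1
        _ ≤ K * (K ^ j * ψ x) := by gcongr; exact ih x hx
        _ = K ^ (j + 1) * ψ x := by ring
  refine ⟨K ^ k, by positivity, ψ (2 ^ k * x₀), ψ.nonneg' _ (by positivity), fun x hx => ?_⟩
  rcases le_total (2 ^ k * x₀) x with h1 | h1
  · have h2 : x₀ ≤ (1 / 2) ^ k * x := by
      rw [one_div, inv_pow, le_inv_mul_iff₀ (by positivity)]
      exact h1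
    have h3 := key k _ h2
    rw [← mul_assoc, ← mul_pow] at h3
    norm_num at h3
    have h4 : ψ ((1 / 2) ^ k * x) ≤ ψ (t * x) :=
      ψ.monotoneOn (mem_Ici.2 (by positivity)) (mem_Ici.2 (by positivity)) (by gcongr)
    have h5 : K ^ k * ψ ((1 / 2) ^ k * x) ≤ K ^ k * ψ (t * x) := by gcongr
    have h6 := ψ.nonneg' (2 ^ k * x₀) (by positivity)
    norm_num at h5
    linarith
  · have h2 := ψ.monotoneOn (mem_Ici.2 hx) (mem_Ici.2 (by positivity)) h1
    have h3 : 0 ≤ K ^ k * ψ (t * x) := mul_nonneg (by positivity) (ψ.nonneg' _ (by positivity))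
    linarith

lemma deltaTwo_power (p : ℝ) (hp : 1 < p) : (power p hp).DeltaTwo := by
  refine ⟨1, one_pos, 2 ^ p, Real.one_lt_rpow (by norm_num) (by linarith), fun x hx => ?_⟩
  exact (Real.mul_rpow (by norm_num) (by linarith)).le

end OrliczFunction

/-- The complex linear map acting as multiplication by `δ` on `ℂ e` and by `√δ` on the orthogonal
complement of the unit vector `e`. -/
noncomputable def anisotropicDilation {N : ℕ} (e : EuclideanSpace ℂ (Fin N)) (δ : ℝ) :
    EuclideanSpace ℂ (Fin N) →L[ℂ] EuclideanSpace ℂ (Fin N) :=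
  ((√δ : ℝ) : ℂ) • ContinuousLinearMap.id ℂ _ +
    ((δ - √δ : ℝ) : ℂ) • (innerSL ℂ e).smulRight e

/-! ### Anisotropic dilations and their Jacobian -/

section AnisotropicDilation

variable {N : ℕ} {e : EuclideanSpace ℂ (Fin N)} {δ : ℝ}

lemma anisotropicDilation_apply (x : EuclideanSpace ℂ (Fin N)) :
    anisotropicDilation e δ x
      = ((√δ : ℝ) : ℂ) • x + (((δ - √δ : ℝ) : ℂ) * inner ℂ e x) • e := by
  simp [anisotropicDilation, smul_smul]

lemma inner_anisotropicDilation (he : ‖e‖ = 1) (x : EuclideanSpace ℂ (Fin N)) :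
    inner ℂ e (anisotropicDilation e δ x) = δ * inner ℂ e x := by
  rw [anisotropicDilation_apply, inner_add_right, inner_smul_right, inner_smul_right,
    inner_self_eq_norm_sq_to_K, he]
  push_cast
  ring

lemma norm_sq_anisotropicDilation (he : ‖e‖ = 1) (hδ : 0 ≤ δ) (x : EuclideanSpace ℂ (Fin N)) :
    ‖anisotropicDilation e δ x‖ ^ 2
      = δ * ‖x‖ ^ 2 + (δ ^ 2 - δ) * ‖inner ℂ e x‖ ^ 2 := by
  rw [anisotropicDilation_apply, @norm_add_sq ℂ, norm_smul, norm_smul, inner_smul_left,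
    inner_smul_right, ← inner_conj_symm x e, mul_pow, mul_pow, he, norm_mul, mul_pow]
  have h1 : ∀ c : ℂ, c * (starRingEnd ℂ) c = ((‖c‖ ^ 2 : ℝ) : ℂ) := by
    intro c; rw [Complex.mul_conj, Complex.normSq_eq_norm_sq]
  rw [mul_assoc (((δ - √δ : ℝ)) : ℂ), h1]
  have h2 : RCLike.re ((starRingEnd ℂ) ((√δ : ℝ) : ℂ) * (((δ - √δ : ℝ) : ℂ) *
      ((‖inner ℂ e x‖ ^ 2 : ℝ) : ℂ))) = √δ * ((δ - √δ) * ‖inner ℂ e x‖ ^ 2) := by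
    rw [Complex.conj_ofReal, ← Complex.ofReal_mul, ← Complex.ofReal_mul]
    exact Complex.ofReal_re _
  rw [h2, Complex.norm_real, Complex.norm_real, Real.norm_eq_abs, Real.norm_eq_abs, sq_abs, sq_abs]
  have h3 := Real.sq_sqrt hδ
  linear_combination (‖x‖ ^ 2 - ‖inner ℂ e x‖ ^ 2) * h3

/-- The map is `√δ` times a rank-one perturbation of the identity of determinant `√δ`, so its
complex determinant is `√δ ^ (N + 1)`. The real determinant is the squared modulus of the complex
one. -/
lemma det_anisotropicDilation (he : ‖e‖ = 1) (hδ : 0 < δ) :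
    LinearMap.det ((anisotropicDilation e δ).toLinearMap.restrictScalars ℝ) = δ ^ (N + 1) := by
  have hs := Real.sqrt_pos.2 hδ
  have h0 : (√δ : ℂ) ≠ 0 := by exact_mod_cast hs.ne'
  have h1 : (anisotropicDilation e δ).toLinearMap = ((√δ : ℝ) : ℂ) •
      LinearMap.transvection (((√δ - 1 : ℝ) : ℂ) • (innerSL ℂ e).toLinearMap) e := by
    ext1 x
    have h3 : (δ : ℂ) = √δ * √δ := by exact_mod_cast (Real.mul_self_sqrt hδ.le).symm
    simp only [ContinuousLinearMap.coe_coe, anisotropicDilation_apply, LinearMap.smul_apply,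
      LinearMap.transvection.apply, innerSL_apply_apply, smul_add, smul_smul, smul_eq_mul]
    congr 2
    push_cast
    rw [h3]
    ring
  rw [LinearMap.det_restrictScalars, h1, LinearMap.det_smul, LinearMap.transvection.det]
  simp only [LinearMap.smul_apply, ContinuousLinearMap.coe_coe, innerSL_apply_apply,
    inner_self_eq_norm_sq_to_K, he, Algebra.norm_complex_apply, finrank_euclideanSpace_fin]
  rw [Complex.normSq_eq_norm_sq]
  have h4 : ((√δ : ℝ) : ℂ) ^ N * (1 + ((√δ - 1 : ℝ) : ℂ) • (((1 : ℝ) : ℂ) ^ 2))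
      = ((√δ ^ (N + 1) : ℝ) : ℂ) := by
    push_cast
    simp
    ring
  refine (congrArg (fun c : ℂ => ‖c‖ ^ 2) h4).trans ?_
  simp only [Complex.norm_real, Real.norm_eq_abs, sq_abs]
  rw [← pow_mul, mul_comm, pow_mul, Real.sq_sqrt hδ.le]

lemma map_anisotropicDilation (he : ‖e‖ = 1) (hδ : 0 < δ) :
    Measure.map (anisotropicDilation e δ) volume
      = ENNReal.ofReal ((δ ^ (N + 1))⁻¹) • volume := by
  have h := Measure.map_linearMap_addHaar_eq_smul_addHaar
    (volume : Measure (EuclideanSpace ℂ (Fin N)))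
    (f := (anisotropicDilation e δ).toLinearMap.restrictScalars ℝ)
    (by rw [det_anisotropicDilation he hδ]; positivity)
  rw [det_anisotropicDilation he hδ, abs_of_pos (by positivity)] at h
  exact h

end AnisotropicDilation

/-! ### Polar coordinates and radial integrals -/

section Polar

variable {E : Type*} [NormedAddCommGroup E] [NormedSpace ℝ E] [Nontrivial E]
  [FiniteDimensional ℝ E] [MeasurableSpace E] [BorelSpace E] (μ : Measure E) [μ.IsAddHaarMeasure]

lemma lintegral_polar {g : E → ℝ≥0∞} (hg : Measurable g) :
    ∫⁻ x, g x ∂μ = ∫⁻ ζ, ∫⁻ r in Ioi (0 : ℝ),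
      ENNReal.ofReal (r ^ (Module.finrank ℝ E - 1)) * g (r • (ζ : E)) ∂volume ∂μ.toSphere := by
  have h0 : MeasurableSet ({0}ᶜ : Set E) := (measurableSet_singleton _).compl
  have h1 : ∫⁻ x, g x ∂μ = ∫⁻ x : ({0}ᶜ : Set E), g x ∂(μ.comap (↑)) := by
    rw [lintegral_subtype_comap h0, restrict_compl_singleton]
  let G : Metric.sphere (0 : E) 1 × Ioi (0 : ℝ) → ℝ≥0∞ := fun p => g ((p.2 : ℝ) • (p.1 : E))
  have hG : Measurable G := by fun_prop
  have h2 : ∀ x : ({0}ᶜ : Set E), g x = G (homeomorphUnitSphereProd E x) := by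
    intro x
    have hx : ‖(x : E)‖ ≠ 0 := norm_ne_zero_iff.2 x.2
    simp [G, smul_smul, mul_inv_cancel₀ hx]
  rw [h1, lintegral_congr h2, (μ.measurePreserving_homeomorphUnitSphereProd).lintegral_comp hG,
    lintegral_prod _ hG.aemeasurable]
  refine lintegral_congr fun ζ => ?_
  rw [Measure.volumeIoiPow, lintegral_withDensity_eq_lintegral_mul _ (by fun_prop) (by fun_prop)]
  exact lintegral_subtype_comap measurableSet_Ioi
    (fun r : ℝ => ENNReal.ofReal (r ^ (Module.finrank ℝ E - 1)) * g (r • (ζ : E)))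

end Polar

/-- The radial integral near the sphere; `α > -1` is what makes it finite. -/
lemma lintegral_one_sub_rpow {α t : ℝ} (hα : -1 < α) (ht : 0 ≤ t) :
    ∫⁻ r in Ioo (1 - t) 1, ENNReal.ofReal ((1 - r) ^ α)
      = ENNReal.ofReal (t ^ (α + 1) / (α + 1)) := by
  have h1 : ∫⁻ r in Ioo (1 - t) 1, ENNReal.ofReal ((1 - r) ^ α)
      = ∫⁻ r in Ioo 0 t, ENNReal.ofReal (r ^ α) := by
    rw [← lintegral_indicator measurableSet_Ioo, ← lintegral_indicator measurableSet_Ioo,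
      ← lintegral_sub_left_eq_self _ (1 : ℝ)]
    refine lintegral_congr fun r => ?_
    have : 1 - r ∈ Ioo (1 - t) 1 ↔ r ∈ Ioo 0 t := by
      simp only [mem_Ioo]
      constructor <;> rintro ⟨h1, h2⟩ <;> constructor <;> linarith
    by_cases hr : r ∈ Ioo 0 t
    · rw [indicator_of_mem hr, indicator_of_mem (this.2 hr), sub_sub_cancel]
    · rw [indicator_of_notMem hr, indicator_of_notMem (mt this.1 hr)]
  have h2 := intervalIntegral.intervalIntegrable_rpow' (a := 0) (b := t) hα
  rw [h1, Measure.restrict_congr_set Ioo_ae_eq_Ioc, ← ofReal_integral_eq_lintegral_ofReal h2.1,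
    ← intervalIntegral.integral_of_le ht, integral_rpow (Or.inl hα),
    Real.zero_rpow (by linarith), sub_zero]
  filter_upwards [ae_restrict_mem measurableSet_Ioc] with r hr
  exact Real.rpow_nonneg hr.1.le _

/-- The factor `(1 + r)^α` lies below `2 ^ |α|` whatever the sign of `α`. -/
lemma one_sub_sq_rpow_le {α r : ℝ} (hr : 0 ≤ r) (hr1 : r < 1) :
    (1 - r ^ 2) ^ α ≤ 2 ^ |α| * (1 - r) ^ α := by
  rw [show 1 - r ^ 2 = (1 + r) * (1 - r) by ring, Real.mul_rpow (by linarith) (by linarith)]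
  refine mul_le_mul_of_nonneg_right ?_ (Real.rpow_nonneg (by linarith) _)
  calc (1 + r) ^ α ≤ (1 + r) ^ |α| :=
        Real.rpow_le_rpow_of_exponent_le (by linarith) (le_abs_self α)
    _ ≤ 2 ^ |α| := Real.rpow_le_rpow (by linarith) (by linarith) (abs_nonneg α)

lemma lintegral_radial_le {α t : ℝ} (hα : -1 < α) (ht : 0 ≤ t) (ht1 : t ≤ 1) (k : ℕ) :
    ∫⁻ r in Ioo (1 - t) 1, ENNReal.ofReal (r ^ k) * ENNReal.ofReal ((1 - r ^ 2) ^ α)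
      ≤ ENNReal.ofReal (2 ^ |α| * (t ^ (α + 1) / (α + 1))) := by
  rw [ENNReal.ofReal_mul (by positivity), ← lintegral_one_sub_rpow hα ht,
    ← lintegral_const_mul _ (by fun_prop)]
  refine setLIntegral_mono (by fun_prop) fun r hr => ?_
  have hr0 : 0 ≤ r := by linarith [hr.1]
  rw [← ENNReal.ofReal_mul (by positivity), ← ENNReal.ofReal_mul (by positivity)]
  refine ENNReal.ofReal_le_ofReal ?_
  refine (mul_le_of_le_one_left (Real.rpow_nonneg ?_ _) (pow_le_one₀ hr0 hr.2.le)).trans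
    (one_sub_sq_rpow_le hr0 hr.2)
  nlinarith [hr.2]

/-! ### Volume of nonisotropic caps -/

section Volume

variable {N : ℕ}

local notation "E" => EuclideanSpace ℂ (Fin N)

/-- The part of the unit ball in which `⟨z, a⟩` is at distance less than `t` from `1`. -/
def ballCap (a : E) (t : ℝ) : Set E := {z | ‖z‖ < 1 ∧ ‖1 - inner ℂ a z‖ < t}

lemma measurableSet_ballCap (a : E) (t : ℝ) : MeasurableSet (ballCap a t) := by
  have h : Continuous fun z : E => ‖1 - inner ℂ a z‖ := by fun_prop
  exact (isOpen_lt continuous_norm continuous_const).measurableSet.inter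
    (isOpen_lt h continuous_const).measurableSet

/-- A cap has size about `t` along `a` and about `√t` in the orthogonal complex directions. The
dilation with parameter `t⁻¹`, centred at `p = a / |a|²`, therefore sends it into a fixed ball, and
its Jacobian `t⁻¹ ^ (N + 1)` gives the volume. For `|a| ≤ 1/2` the cap is empty, because `t ≤ 1/2`.
-/
lemma volume_ballCap_le {a : E} (ha : ‖a‖ ≤ 1) {t : ℝ} (ht : 0 < t) (ht1 : t ≤ 1 / 2) :
    volume (ballCap a t) ≤ ENNReal.ofReal (t ^ (N + 1)) * volume (Metric.ball (0 : E) 3) := by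
  rcases le_or_gt ‖a‖ (1 / 2) with h | h
  · suffices ballCap a t = ∅ by simp [this]
    refine eq_empty_of_forall_notMem fun z hz => ?_
    have h1 := norm_inner_le_norm (𝕜 := ℂ) a z
    have h2 := norm_sub_norm_le (1 : ℂ) (inner ℂ a z)
    rw [norm_one] at h2
    nlinarith [hz.1, hz.2, norm_nonneg z, norm_nonneg a]
  · set ρ := ‖a‖ with hρ
    have hρ0 : 0 < ρ := by linarith
    obtain ⟨e, he'⟩ : ∃ e : E, e = ((ρ⁻¹ : ℝ) : ℂ) • a := ⟨_, rfl⟩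
    have he : ‖e‖ = 1 := by
      rw [he', norm_smul, Complex.norm_real, Real.norm_eq_abs, abs_of_pos (by positivity), ← hρ,
        inv_mul_cancel₀ hρ0.ne']
    have hae : ∀ z, inner ℂ a z = ρ * inner ℂ e z := by
      intro z
      rw [he', inner_smul_left, Complex.conj_ofReal, ← mul_assoc, ← Complex.ofReal_mul,
        mul_inv_cancel₀ hρ0.ne', Complex.ofReal_one, one_mul]
    have hA := map_anisotropicDilation he (inv_pos.2 ht)
    set p : E := ((ρ⁻¹ : ℝ) : ℂ) • e with hp
    have hsub : ballCap a t ⊆ (fun z => z - p) ⁻¹'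
        (anisotropicDilation e t⁻¹ ⁻¹' Metric.ball 0 3) := by
      intro z hz
      obtain ⟨hz1, hz2⟩ := hz
      rw [mem_preimage, mem_preimage, mem_ball_zero_iff]
      refine lt_of_pow_lt_pow_left₀ 2 (by norm_num) ?_
      rw [norm_sq_anisotropicDilation he (by positivity), @norm_sub_sq ℂ, inner_sub_right, hp,
        inner_smul_right, inner_smul_right, norm_smul, he, Complex.norm_real,
        inner_self_eq_norm_sq_to_K, he]
      rw [hae] at hz2
      set c := inner ℂ e z with hc
      have hcz : inner ℂ z e = (starRingEnd ℂ) c := (inner_conj_symm z e).symm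
      rw [hcz]
      have hre : RCLike.re (((ρ⁻¹ : ℝ) : ℂ) * (starRingEnd ℂ) c) = ρ⁻¹ * c.re := by
        simp
      rw [hre]
      have hcn : ‖c - ((ρ⁻¹ : ℝ) : ℂ) * (((1 : ℝ) : ℂ)) ^ 2‖ < 2 * t := by
        have : c - ((ρ⁻¹ : ℝ) : ℂ) * ((1 : ℝ) : ℂ) ^ 2 = -((ρ⁻¹ : ℝ) : ℂ) * (1 - ρ * c) := by
          have : (ρ : ℂ) ≠ 0 := by exact_mod_cast hρ0.ne'
          push_cast
          field_simp
          ring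
        rw [this, norm_mul, norm_neg, Complex.norm_real, Real.norm_eq_abs, abs_of_pos (by positivity)]
        have h3 : ρ⁻¹ ≤ 2 := by
          rw [inv_le_comm₀ hρ0 (by norm_num)]; linarith
        have := norm_nonneg (1 - ρ * c)
        nlinarith
      have hcs : ‖c - ((ρ⁻¹ : ℝ) : ℂ) * (((1 : ℝ) : ℂ)) ^ 2‖ ^ 2
          = ‖c‖ ^ 2 - 2 * (ρ⁻¹ * c.re) + ρ⁻¹ ^ 2 := by
        rw [← Complex.normSq_eq_norm_sq, ← Complex.normSq_eq_norm_sq, Complex.normSq_apply,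
          Complex.normSq_apply]
        simp
        ring
      have hc1 : ‖c‖ ≤ ‖z‖ := by
        have := norm_inner_le_norm (𝕜 := ℂ) e z
        rwa [he, one_mul] at this
      have hc2 : 1 - ‖c‖ < t := by
        have h2 := norm_sub_norm_le (1 : ℂ) (ρ * c)
        rw [norm_one, norm_mul, Complex.norm_real, Real.norm_eq_abs, abs_of_pos hρ0] at h2
        nlinarith [norm_nonneg c]
      have hd0 := norm_nonneg (c - ((ρ⁻¹ : ℝ) : ℂ) * (((1 : ℝ) : ℂ)) ^ 2)
      set d := ‖c - ((ρ⁻¹ : ℝ) : ℂ) * (((1 : ℝ) : ℂ)) ^ 2‖ with hd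
      have hd2 : t⁻¹ ^ 2 * d ^ 2 < 4 := by
        rw [← mul_pow]
        have h1 : t⁻¹ * d < 2 := by
          rw [inv_mul_lt_iff₀ ht]; linarith
        have h2 : 0 ≤ t⁻¹ * d := by positivity
        nlinarith
      have hz3 : t⁻¹ * (‖z‖ ^ 2 - ‖c‖ ^ 2) < 2 := by
        rw [inv_mul_lt_iff₀ ht]
        nlinarith [norm_nonneg z, norm_nonneg c]
      have habs : ‖ρ⁻¹‖ ^ 2 = ρ⁻¹ ^ 2 := by rw [Real.norm_eq_abs, sq_abs]
      rw [mul_one, habs]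
      -- Pythagoras: the part orthogonal to `e` contributes less than 2, the part along `e` less
      -- than 4, and 6 is below `3 ^ 2`.
      have key : t⁻¹ * (‖z‖ ^ 2 - 2 * (ρ⁻¹ * c.re) + ρ⁻¹ ^ 2) + (t⁻¹ ^ 2 - t⁻¹) * d ^ 2
          = t⁻¹ * (‖z‖ ^ 2 - ‖c‖ ^ 2) + t⁻¹ ^ 2 * d ^ 2 := by
        rw [hcs]; ring
      refine (le_of_eq key).trans_lt ?_
      linarith
    refine (measure_mono hsub).trans ?_
    have hm : MeasurableSet (anisotropicDilation e t⁻¹ ⁻¹' Metric.ball (0 : E) 3) :=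
      (anisotropicDilation e t⁻¹).continuous.measurable measurableSet_ball
    rw [(measurePreserving_sub_right volume p).measure_preimage hm.nullMeasurableSet,
      ← Measure.map_apply (anisotropicDilation e t⁻¹).continuous.measurable measurableSet_ball, hA,
      inv_pow, inv_inv]
    rfl

/-- In polar coordinates a cap lies over the spherical cap of radius `2 * t`, within the shell `1 -
t < r < 1`. The weight integrates over the shell to order `t ^ (α + 1)`. The spherical cap has
measure of order `t ^ N`: the shell over it lies in a solid cap of radius `3 * t`, whose volume is
known from `volume_ballCap_le`. -/
lemma lintegral_ballCap_le {α : ℝ} (hα : -1 < α) (hN : 1 ≤ N) :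
    ∃ C : ℝ≥0∞, C ≠ ∞ ∧ ∀ a : E, ‖a‖ ≤ 1 → ∀ t, 0 < t →
      ∫⁻ z in ballCap a t, ENNReal.ofReal ((1 - ‖z‖ ^ 2) ^ α)
        ≤ C * ENNReal.ofReal (t ^ (N + 1 + α)) := by
  have : Nonempty (Fin N) := ⟨⟨0, hN⟩⟩
  have : Nontrivial E := inferInstance
  set σ := (volume : Measure E).toSphere
  set k := Module.finrank ℝ E - 1
  have hpol : ∀ g : E → ℝ≥0∞, Measurable g → ∫⁻ x, g x = ∫⁻ ζ, ∫⁻ r in Ioi (0 : ℝ),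
      ENNReal.ofReal (r ^ k) * g (r • (ζ : E)) ∂volume ∂σ := fun g hg => lintegral_polar _ hg
  have hnorm : ∀ (ζ : Metric.sphere (0 : E) 1) (r : ℝ), 0 < r → ‖r • (ζ : E)‖ = r := by
    intro ζ r hr
    rw [norm_smul, norm_eq_of_mem_sphere, mul_one, Real.norm_of_nonneg hr.le]
  have hw : Measurable fun z : E => ENNReal.ofReal ((1 - ‖z‖ ^ 2) ^ α) := by fun_prop
  have hcm : ∀ a : E, ∀ t,
      MeasurableSet {ζ : Metric.sphere (0 : E) 1 | ‖1 - inner ℂ a (ζ : E)‖ < t} := by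
    intro a t
    have h : Continuous fun ζ : Metric.sphere (0 : E) 1 => ‖1 - inner ℂ a (ζ : E)‖ := by fun_prop
    exact (isOpen_lt h continuous_const).measurableSet
  -- upper bound in polar coordinates
  have hup : ∀ (S : Set E) (Z : Set (Metric.sphere (0 : E) 1)) (t : ℝ), MeasurableSet S →
      MeasurableSet Z → 0 < t → t ≤ 1 → (∀ (ζ : Metric.sphere (0 : E) 1) (r : ℝ), 0 < r →
        r • (ζ : E) ∈ S → ζ ∈ Z ∧ r ∈ Ioo (1 - t) 1) →
      ∫⁻ z in S, ENNReal.ofReal ((1 - ‖z‖ ^ 2) ^ α)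
        ≤ ENNReal.ofReal (2 ^ |α| * (t ^ (α + 1) / (α + 1))) * σ Z := by
    intro S Z t hS hZ ht ht1 h
    rw [← lintegral_indicator hS, hpol _ (hw.indicator hS), ← lintegral_indicator_const hZ]
    refine lintegral_mono fun ζ => ?_
    have hle : ∫⁻ r in Ioi (0 : ℝ), ENNReal.ofReal (r ^ k) *
        S.indicator (fun z => ENNReal.ofReal ((1 - ‖z‖ ^ 2) ^ α)) (r • (ζ : E))
        ≤ ∫⁻ r in Ioi (0 : ℝ), Z.indicator (fun _ => (Ioo (1 - t) 1).indicator (fun r =>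
          ENNReal.ofReal (r ^ k) * ENNReal.ofReal ((1 - r ^ 2) ^ α)) r) ζ := by
      refine setLIntegral_mono' measurableSet_Ioi fun r hr => ?_
      by_cases hrS : r • (ζ : E) ∈ S
      · obtain ⟨h1, h2⟩ := h ζ r hr hrS
        rw [indicator_of_mem hrS, indicator_of_mem h1, indicator_of_mem h2, hnorm ζ r hr]
      · rw [indicator_of_notMem hrS, mul_zero]
        exact zero_le
    refine hle.trans ?_
    by_cases hζ : ζ ∈ Z
    · simp only [indicator_of_mem hζ]
      refine (setLIntegral_le_lintegral _ _).trans ?_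
      rw [lintegral_indicator measurableSet_Ioo]
      exact lintegral_radial_le hα ht.le ht1 k
    · simp [indicator_of_notMem hζ]
  -- measure of spherical caps
  have hsph : ∀ a : E, ‖a‖ ≤ 1 → ∀ t, 0 < t → t ≤ 1 / 6 →
      σ {ζ | ‖1 - inner ℂ a (ζ : E)‖ < 2 * t} * ENNReal.ofReal ((1 / 2) ^ k * t)
        ≤ ENNReal.ofReal ((3 * t) ^ (N + 1)) * volume (Metric.ball (0 : E) 3) := by
    intro a ha t ht ht1
    refine le_trans ?_ (volume_ballCap_le ha (t := 3 * t) (by linarith) (by linarith))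
    have hm := measurableSet_ballCap a (3 * t)
    rw [← lintegral_indicator_one hm, hpol _ (measurable_one.indicator hm), mul_comm,
      ← lintegral_indicator_const (hcm a (2 * t))]
    refine lintegral_mono fun ζ => ?_
    by_cases hζ : ζ ∈ {ζ : Metric.sphere (0 : E) 1 | ‖1 - inner ℂ a (ζ : E)‖ < 2 * t}
    · rw [indicator_of_mem hζ]
      -- Since `t ≤ 1/6`, the radius exceeds `1/2` on the shell and the density `r ^ k` is at least
      -- `(1 / 2) ^ k`.
      have h1 : ENNReal.ofReal ((1 / 2) ^ k * t)
          = ∫⁻ r in Ioo (1 - t) 1, ENNReal.ofReal ((1 / 2) ^ k) := by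
        rw [setLIntegral_const, Real.volume_Ioo, ← ENNReal.ofReal_mul (by positivity)]
        congr 2
        ring
      rw [h1]
      have hsub : Ioo (1 - t) 1 ⊆ Ioi (0 : ℝ) := fun r hr => by
        have := hr.1
        exact mem_Ioi.2 (by linarith)
      refine le_trans (setLIntegral_mono' measurableSet_Ioo fun r hr => ?_)
        (lintegral_mono_set hsub)
      have hr0 : 0 < r := hsub hr
      have hmem : r • (ζ : E) ∈ ballCap a (3 * t) := by
        refine ⟨by rw [hnorm ζ r hr0]; exact hr.2, ?_⟩
        have hζ' : ‖1 - inner ℂ a (ζ : E)‖ < 2 * t := hζ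
        have h2 : inner ℂ a (r • (ζ : E)) = r * inner ℂ a (ζ : E) := by
          rw [← Complex.coe_smul, inner_smul_right]
        have h3 : 1 - inner ℂ a (r • (ζ : E)) = (1 - inner ℂ a (ζ : E))
            + ((1 - r : ℝ) : ℂ) * inner ℂ a (ζ : E) := by
          rw [h2]; push_cast; ring
        rw [h3]
        refine (norm_add_le _ _).trans_lt ?_
        rw [norm_mul, Complex.norm_real, Real.norm_of_nonneg (by linarith [hr.2])]
        have h4 := norm_inner_le_norm (𝕜 := ℂ) a (ζ : E)
        rw [norm_eq_of_mem_sphere, mul_one] at h4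
        have := norm_nonneg (inner ℂ a (ζ : E))
        nlinarith [hr.1, hr.2]
      rw [indicator_of_mem hmem, Pi.one_apply, mul_one]
      exact ENNReal.ofReal_le_ofReal (pow_le_pow_left₀ (by norm_num) (by linarith [hr.1]) k)
    · rw [indicator_of_notMem hζ]
      exact zero_le
  set B := volume (Metric.ball (0 : E) 3) with hB
  have hBtop : B ≠ ∞ := measure_ball_lt_top.ne
  set c₁ : ℝ := 2 ^ |α| / (α + 1) with hc₁
  have hc₁0 : 0 ≤ c₁ := div_nonneg (by positivity) (by linarith)
  have hcap : ∀ a : E, ‖a‖ ≤ 1 → ∀ t, 0 < t → t ≤ 1 / 6 →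
      ∫⁻ z in ballCap a t, ENNReal.ofReal ((1 - ‖z‖ ^ 2) ^ α)
        ≤ (ENNReal.ofReal (c₁ * 3 ^ (N + 1) * 2 ^ k) * B)
          * ENNReal.ofReal (t ^ (N + 1 + α)) := by
    intro a ha t ht ht1
    refine (hup (ballCap a t) _ t (measurableSet_ballCap a t) (hcm a (2 * t)) ht (by linarith)
      fun ζ r hr hz => ?_).trans ?_
    · have h1 := hz.1
      have h2 := hz.2
      rw [hnorm ζ r hr] at h1
      rw [← Complex.coe_smul, inner_smul_right] at h2
      have h4 := norm_inner_le_norm (𝕜 := ℂ) a (ζ : E)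
      rw [norm_eq_of_mem_sphere, mul_one] at h4
      have h5 := norm_sub_norm_le (1 : ℂ) (r * inner ℂ a (ζ : E))
      rw [norm_one, norm_mul, Complex.norm_real, Real.norm_of_nonneg hr.le] at h5
      have h6 := norm_nonneg (inner ℂ a (ζ : E))
      have hr1 : 1 - t < r := by nlinarith
      refine ⟨?_, hr1, h1⟩
      have h3 : 1 - inner ℂ a (ζ : E) = (1 - r * inner ℂ a (ζ : E))
            - ((1 - r : ℝ) : ℂ) * inner ℂ a (ζ : E) := by
        push_cast; ring
      change ‖1 - inner ℂ a (ζ : E)‖ < 2 * t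
      rw [h3]
      refine (norm_sub_le _ _).trans_lt ?_
      rw [norm_mul, Complex.norm_real, Real.norm_of_nonneg (by linarith)]
      change ‖1 - r * inner ℂ a (ζ : E)‖ < t at h2
      nlinarith
    · have h1 := hsph a ha t ht ht1
      set s := σ {ζ | ‖1 - inner ℂ a (ζ : E)‖ < 2 * t}
      have h2 : 2 ^ |α| * (t ^ (α + 1) / (α + 1))
          = c₁ * 2 ^ k * t ^ α * ((1 / 2) ^ k * t) := by
        rw [Real.rpow_add_one ht.ne', hc₁, one_div, inv_pow]
        field_simp
      have h3 : ENNReal.ofReal (t ^ (N + 1 + α)) = ENNReal.ofReal (t ^ α)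
          * ENNReal.ofReal (t ^ (N + 1)) := by
        rw [← ENNReal.ofReal_mul (by positivity), Real.rpow_add ht, mul_comm]
        congr 2
        exact_mod_cast Real.rpow_natCast t (N + 1)
      rw [h2, h3, ENNReal.ofReal_mul (by positivity), mul_assoc, mul_comm (ENNReal.ofReal _) s]
      refine (mul_le_mul_right h1 _).trans (le_of_eq ?_)
      rw [mul_pow, ENNReal.ofReal_mul (by positivity), ENNReal.ofReal_mul (by positivity),
        ENNReal.ofReal_mul (by positivity : 0 ≤ (3 : ℝ) ^ (N + 1)),
        ENNReal.ofReal_mul (by positivity : 0 ≤ c₁ * 3 ^ (N + 1)),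
        ENNReal.ofReal_mul hc₁0]
      ring
  have htot : ∫⁻ z in Metric.ball (0 : E) 1, ENNReal.ofReal ((1 - ‖z‖ ^ 2) ^ α)
      ≤ ENNReal.ofReal c₁ * σ univ := by
    refine (hup (Metric.ball (0 : E) 1) univ 1 measurableSet_ball MeasurableSet.univ one_pos
      le_rfl fun ζ r hr hz => ⟨mem_univ _, ?_⟩).trans (le_of_eq ?_)
    · rw [mem_ball_zero_iff, hnorm ζ r hr] at hz
      exact ⟨by linarith, hz⟩
    · rw [Real.one_rpow, hc₁, mul_one_div]
  set C₁ := ENNReal.ofReal (c₁ * 3 ^ (N + 1) * 2 ^ k) * B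
  set C₂ := ENNReal.ofReal c₁ * σ univ
  have hn : 0 < N + 1 + α := by
    have : (0 : ℝ) ≤ N := N.cast_nonneg
    linarith
  -- The second term serves `t ≥ 1/6`: there the total mass suffices, as `(6 * t) ^ (N + 1 + α) ≥
  -- 1`.
  refine ⟨C₁ + C₂ * ENNReal.ofReal (6 ^ (N + 1 + α)), ?_, fun a ha t ht => ?_⟩
  · refine ENNReal.add_ne_top.2 ⟨ENNReal.mul_ne_top ENNReal.ofReal_ne_top hBtop,
      ENNReal.mul_ne_top (ENNReal.mul_ne_top ENNReal.ofReal_ne_top (measure_ne_top _ _))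
        ENNReal.ofReal_ne_top⟩
  · rw [add_mul]
    rcases le_total t (1 / 6) with h | h
    · exact (hcap a ha t ht h).trans le_self_add
    · refine le_trans ?_ le_add_self
      have hsub : ballCap a t ⊆ Metric.ball 0 1 := fun z hz => mem_ball_zero_iff.2 hz.1
      refine (lintegral_mono_set hsub).trans (htot.trans ?_)
      rw [mul_assoc, ← ENNReal.ofReal_mul (by positivity),
        ← Real.mul_rpow (by norm_num) (by linarith)]
      refine le_mul_of_one_le_right' ?_
      rw [ENNReal.one_le_ofReal]
      exact Real.one_le_rpow (by linarith) hn.le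

end Volume

/-! ### Cap and kernel estimates for the weighted volume -/

section WeightedVolume

variable {N : ℕ} {α : ℝ}

local notation "E" => EuclideanSpace ℂ (Fin N)

lemma weightConst_pos (hα : -1 < α) : 0 < weightConst N α := by
  have hN : (0 : ℝ) ≤ N := N.cast_nonneg
  exact div_pos (Real.Gamma_pos_of_pos (by linarith))
    (mul_pos (by exact_mod_cast N.factorial_pos) (Real.Gamma_pos_of_pos (by linarith)))

/-- The factor between the weighted volume and `(1 - |z|²)^α dz`. -/
noncomputable def weightFactor (N : ℕ) (α : ℝ) : ℝ≥0∞ :=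
  (volume (cBall N))⁻¹ * ENNReal.ofReal (weightConst N α)

lemma weightFactor_ne_top : weightFactor N α ≠ ∞ :=
  ENNReal.mul_ne_top (ENNReal.inv_ne_top.2 (Metric.measure_ball_pos _ _ one_pos).ne')
    ENNReal.ofReal_ne_top

lemma weightFactor_ne_zero (hα : -1 < α) : weightFactor N α ≠ 0 :=
  mul_ne_zero (ENNReal.inv_ne_zero.2 measure_ball_lt_top.ne)
    (ENNReal.ofReal_pos.2 (weightConst_pos hα)).ne'

lemma one_sub_sq_pos (z : cBall N) : 0 < 1 - ‖(z : E)‖ ^ 2 := by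
  have hz : ‖(z : E)‖ < 1 := mem_ball_zero_iff.1 z.2
  nlinarith [norm_nonneg (z : E)]

lemma lintegral_weightedVolume (hα : -1 < α) {g : E → ℝ≥0∞}
    (hg : Measurable fun z : cBall N => g z) :
    ∫⁻ z : cBall N, g z ∂(weightedVolume N α) = weightFactor N α *
      ∫⁻ z in cBall N, ENNReal.ofReal ((1 - ‖z‖ ^ 2) ^ α) * g z := by
  rw [weightedVolume, lintegral_withDensity_eq_lintegral_mul _ (by fun_prop) hg, ballVolume,
    lintegral_smul_measure, ballLebesgue_univ, ballLebesgue, weightFactor, mul_assoc,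
    ← lintegral_const_mul' _ _ ENNReal.ofReal_ne_top, smul_eq_mul]
  congr 1
  rw [← lintegral_subtype_comap measurableSet_ball]
  refine lintegral_congr fun z => ?_
  rw [Pi.mul_apply, ENNReal.ofReal_mul (weightConst_pos hα).le, mul_assoc]

lemma exists_lintegral_weightedVolume_cap_le (hN : 1 ≤ N) (hα : -1 < α) :
    ∃ C : ℝ≥0∞, C ≠ ∞ ∧ ∀ a : E, ‖a‖ ≤ 1 → ∀ t, 0 < t →
      weightedVolume N α {z | ‖1 - inner ℂ a (z : E)‖ < t}
        ≤ C * ENNReal.ofReal (t ^ (N + 1 + α)) := by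
  obtain ⟨C, hC, h⟩ := lintegral_ballCap_le (N := N) hα hN
  refine ⟨weightFactor N α * C, ENNReal.mul_ne_top weightFactor_ne_top hC, fun a ha t ht => ?_⟩
  have hm := measurableSet_ballCap a t
  have h1 : {z : cBall N | ‖1 - inner ℂ a (z : E)‖ < t} = Subtype.val ⁻¹' ballCap a t := by
    ext z
    exact ⟨fun hz => ⟨mem_ball_zero_iff.1 z.2, hz⟩, fun hz => hz.2⟩
  have h2 := lintegral_weightedVolume (N := N) hα (g := (ballCap a t).indicator 1)
    ((measurable_one.indicator hm).comp measurable_subtype_coe)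
  have h3 : ∀ z : cBall N, (ballCap a t).indicator (1 : E → ℝ≥0∞) z
    = (Subtype.val ⁻¹' ballCap a t : Set (cBall N)).indicator 1 z := fun z => rfl
  rw [lintegral_congr h3, lintegral_indicator_one (measurable_subtype_coe hm)] at h2
  rw [h1, h2, mul_assoc]
  refine mul_le_mul_right (le_trans (le_of_eq ?_) (h a ha t ht)) _
  have h4 : ∀ z : E, ENNReal.ofReal ((1 - ‖z‖ ^ 2) ^ α) * (ballCap a t).indicator 1 z
      = (ballCap a t).indicator (fun z => ENNReal.ofReal ((1 - ‖z‖ ^ 2) ^ α)) z := by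
    intro z
    by_cases hz : z ∈ ballCap a t <;> simp [hz]
  rw [lintegral_congr h4, setLIntegral_indicator hm, inter_eq_left.2]
  exact fun z hz => mem_ball_zero_iff.2 hz.1

lemma isFiniteMeasure_weightedVolume (hN : 1 ≤ N) (hα : -1 < α) :
    IsFiniteMeasure (weightedVolume N α) := by
  obtain ⟨C, hC, h⟩ := exists_lintegral_weightedVolume_cap_le hN hα
  refine ⟨?_⟩
  -- For `a = 0` the cap of radius 2 is the whole ball.
  have h1 := h 0 (by simp) 2 two_pos
  have h2 : {z : cBall N | ‖1 - inner ℂ (0 : E) (z : E)‖ < 2} = univ := by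
    ext z; simp
  rw [h2] at h1
  exact h1.trans_lt (ENNReal.mul_lt_top hC.lt_top ENNReal.ofReal_lt_top)

/-- The right side is at least `1 - |a|`, and `1 - |a|² ≤ 2 (1 - |a|)`. -/
lemma half_one_sub_sq_le_norm_one_sub_inner (a z : cBall N) :
    (1 - ‖(a : E)‖ ^ 2) / 2 ≤ ‖1 - inner ℂ (a : E) (z : E)‖ := by
  have ha : ‖(a : E)‖ < 1 := mem_ball_zero_iff.1 a.2
  have hz : ‖(z : E)‖ < 1 := mem_ball_zero_iff.1 z.2
  have h1 := norm_inner_le_norm (𝕜 := ℂ) (a : E) (z : E)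
  have h2 := norm_sub_norm_le (1 : ℂ) (inner ℂ (a : E) (z : E))
  rw [norm_one] at h2
  nlinarith [norm_nonneg (a : E)]

/-- A case of the Forelli--Rudin estimates. -/
lemma exists_lintegral_kernel_le (hN : 1 ≤ N) (hα : -1 < α) {m : ℕ} (hm : N + 2 + α ≤ m) :
    ∃ C : ℝ≥0∞, C ≠ ∞ ∧ ∀ a : cBall N,
      ∫⁻ z : cBall N, ENNReal.ofReal
        (((1 - ‖(a : E)‖ ^ 2) / ‖1 - inner ℂ (a : E) (z : E)‖) ^ m) ∂(weightedVolume N α)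
        ≤ C * ENNReal.ofReal ((1 - ‖(a : E)‖ ^ 2) ^ (N + 1 + α)) := by
  obtain ⟨C, hC, h⟩ := exists_lintegral_weightedVolume_cap_le hN hα
  refine ⟨2 ^ m * C * ∑' j : ℕ, (2⁻¹ : ℝ≥0∞) ^ j, ?_, fun a => ?_⟩
  · refine ENNReal.mul_ne_top (ENNReal.mul_ne_top (by simp) hC) ?_
    rw [ENNReal.tsum_geometric]
    simp
  set δ := 1 - ‖(a : E)‖ ^ 2 with hδ
  have hδ0 : 0 < δ := one_sub_sq_pos a
  have ha : ‖(a : E)‖ ≤ 1 := (mem_ball_zero_iff.1 a.2).le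
  -- Dyadic decomposition. Each `z` lies in some `S j` on which the kernel quotient at `z` is at
  -- most `2 * 2⁻¹ ^ j`, while `S j` has mass at most a constant times `(2 ^ j * δ) ^ (N + 1 + α)`.
  -- As `m ≥ N + 2 + α`, the products decay at least like `2⁻¹ ^ j`.
  let S : ℕ → Set (cBall N) := fun j => {z | ‖1 - inner ℂ (a : E) (z : E)‖ < 2 ^ j * δ}
  have hS : ∀ j, MeasurableSet (S j) := by
    intro j
    have h : Continuous fun z : cBall N => ‖1 - inner ℂ (a : E) (z : E)‖ := by fun_prop
    exact (isOpen_lt h continuous_const).measurableSet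
  have hpt : ∀ z : cBall N, ENNReal.ofReal ((δ / ‖1 - inner ℂ (a : E) (z : E)‖) ^ m)
      ≤ ∑' j, (S j).indicator (fun _ => 2 ^ m * ((2⁻¹ : ℝ≥0∞) ^ m) ^ j) z := by
    intro z
    have h1 := half_one_sub_sq_le_norm_one_sub_inner a z
    set q := ‖1 - inner ℂ (a : E) (z : E)‖ with hq
    have hq0 : 0 < q := by linarith
    obtain ⟨j, hj1, hj2⟩ := exists_nat_pow_near (x := q / (δ / 2)) (y := 2)
      (by rw [one_le_div (by positivity)]; exact h1) one_lt_two
    rw [le_div_iff₀ (by positivity)] at hj1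
    rw [div_lt_iff₀ (by positivity)] at hj2
    refine le_trans ?_ (ENNReal.le_tsum j)
    have hmem : z ∈ S j := by
      change q < 2 ^ j * δ
      calc q < 2 ^ (j + 1) * (δ / 2) := hj2
        _ = 2 ^ j * δ := by ring
    rw [indicator_of_mem hmem, ← pow_mul, mul_comm m j, pow_mul, ← mul_pow, ENNReal.ofReal_pow
      (by positivity)]
    refine pow_le_pow_left' ?_ m
    have h3 : (2 : ℝ≥0∞) * 2⁻¹ ^ j = ENNReal.ofReal (2 * (2⁻¹) ^ j) := by
      rw [ENNReal.ofReal_mul (by norm_num), ENNReal.ofReal_pow (by norm_num),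
        ENNReal.ofReal_inv_of_pos (by norm_num)]
      simp
    rw [h3]
    refine ENNReal.ofReal_le_ofReal ?_
    rw [div_le_iff₀ hq0, inv_pow]
    have h4 : (0 : ℝ) < 2 ^ j := by positivity
    calc δ = 2 * ((2 ^ j)⁻¹ * (2 ^ j * (δ / 2))) := by field_simp
      _ ≤ 2 * ((2 ^ j)⁻¹ * q) := by gcongr
      _ = _ := by ring
  refine (lintegral_mono hpt).trans ?_
  rw [lintegral_tsum fun j => (measurable_const.indicator (hS j)).aemeasurable]
  simp_rw [lintegral_indicator_const (hS _)]
  have hj : ∀ j, 2 ^ m * ((2⁻¹ : ℝ≥0∞) ^ m) ^ j * weightedVolume N α (S j)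
      ≤ 2 ^ m * C * 2⁻¹ ^ j * ENNReal.ofReal (δ ^ (N + 1 + α)) := by
    intro j
    have h1 := h a ha (2 ^ j * δ) (by positivity)
    have hpw : (2⁻¹ : ℝ≥0∞) ^ m = ENNReal.ofReal (2⁻¹ ^ m) := by
      rw [ENNReal.ofReal_pow (by norm_num), ENNReal.ofReal_inv_of_pos (by norm_num)]
      simp
    have h2' : (2⁻¹ : ℝ≥0∞) = ENNReal.ofReal 2⁻¹ := by
      rw [ENNReal.ofReal_inv_of_pos (by norm_num)]
      simp
    have h2 : ((2⁻¹ : ℝ≥0∞) ^ m) ^ j * ENNReal.ofReal ((2 ^ j * δ) ^ (N + 1 + α))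
        ≤ 2⁻¹ ^ j * ENNReal.ofReal (δ ^ (N + 1 + α)) := by
      rw [h2', ← ENNReal.ofReal_pow (by norm_num), ← ENNReal.ofReal_pow (by positivity),
        ← ENNReal.ofReal_pow (by positivity), ← ENNReal.ofReal_mul (by positivity),
        ← ENNReal.ofReal_mul (by positivity)]
      refine ENNReal.ofReal_le_ofReal ?_
      rw [Real.mul_rpow (by positivity) hδ0.le, ← mul_assoc]
      refine mul_le_mul_of_nonneg_right ?_ (by positivity)
      rw [← Real.rpow_natCast 2 j, ← Real.rpow_mul (by norm_num), mul_comm (j : ℝ),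
        Real.rpow_mul (by norm_num), Real.rpow_natCast, ← mul_pow]
      refine pow_le_pow_left₀ (by positivity) ?_ j
      rw [inv_pow, inv_mul_le_iff₀ (by positivity), ← Real.rpow_natCast 2 m,
        ← Real.rpow_neg_one 2, ← Real.rpow_add two_pos]
      exact Real.rpow_le_rpow_of_exponent_le (by norm_num) (by linarith)
    calc 2 ^ m * ((2⁻¹ : ℝ≥0∞) ^ m) ^ j * weightedVolume N α (S j)
        ≤ 2 ^ m * ((2⁻¹ : ℝ≥0∞) ^ m) ^ j * (C * ENNReal.ofReal ((2 ^ j * δ) ^ (N + 1 + α))) :=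
          mul_le_mul_right h1 _
      _ = 2 ^ m * C * (((2⁻¹ : ℝ≥0∞) ^ m) ^ j * ENNReal.ofReal ((2 ^ j * δ) ^ (N + 1 + α))) := by
          ring
      _ ≤ 2 ^ m * C * (2⁻¹ ^ j * ENNReal.ofReal (δ ^ (N + 1 + α))) := mul_le_mul_right h2 _
      _ = _ := by ring
  refine (ENNReal.tsum_le_tsum hj).trans (le_of_eq ?_)
  rw [ENNReal.tsum_mul_right, ENNReal.tsum_mul_left]

end WeightedVolume

/-- The representative of a holomorphic function is arbitrary off the ball, so only its truncations
can be integrated over the whole space. -/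
lemma ContinuousOn.measurable_indicator {X : Type*} [TopologicalSpace X] [MeasurableSpace X]
    [OpensMeasurableSpace X] {S : Set X} {U : X → ℝ≥0∞} (hU : ContinuousOn U S)
    (hS : MeasurableSet S) : Measurable (S.indicator U) := by
  classical
  have h := hU.measurable_piecewise (g := fun _ => (0 : ℝ≥0∞)) (continuousOn_const) hS
  rwa [← piecewise_eq_indicator]

/-! ### Jensen's inequality on circles -/

namespace OrliczFunction

variable (ψ : OrliczFunction)

lemma continuous_comp_norm {F : Type*} [SeminormedAddCommGroup F] :
    Continuous fun x : F => ψ ‖x‖ :=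
  ψ.continuousOn.comp_continuous continuous_norm fun x => norm_nonneg x

/-- Jensen's inequality and the mean value property on a circle. -/
lemma ofReal_le_lintegral_circle {g : ℂ → ℂ} (hg : DiffContOnCl ℂ g (Metric.ball 0 1)) :
    ENNReal.ofReal (ψ ‖g 0‖) ≤ ENNReal.ofReal (2 * Real.pi)⁻¹ *
      ∫⁻ θ in Ioc 0 (2 * Real.pi), ENNReal.ofReal (ψ ‖g (circleMap 0 1 θ)‖) := by
  have hpi : 0 < 2 * Real.pi := by positivity
  have hc : Continuous fun θ => g (circleMap 0 1 θ) := by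
    refine hg.continuousOn_ball.comp_continuous (continuous_circleMap 0 1) fun θ => ?_
    exact circleMap_mem_closedBall 0 zero_le_one θ
  have h1 : g 0 = (2 * Real.pi)⁻¹ • ∫ θ in 0..2 * Real.pi, g (circleMap 0 1 θ) := by
    have := DiffContOnCl.circleAverage (f := g) (c := 0) (R := 1) (by simpa using hg)
    exact this.symm
  have hvol : volume.real (Ioc 0 (2 * Real.pi)) = 2 * Real.pi := by
    rw [Real.volume_real_Ioc_of_le hpi.le, sub_zero]
  have h2 : ‖g 0‖ ≤ ⨍ θ in Ioc 0 (2 * Real.pi), ‖g (circleMap 0 1 θ)‖ := by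
    rw [h1, setAverage_eq, hvol, norm_smul, Real.norm_of_nonneg (by positivity), smul_eq_mul,
      intervalIntegral.integral_of_le hpi.le]
    exact mul_le_mul_of_nonneg_left (norm_integral_le_integral_norm _) (by positivity)
  have hc2 : Continuous fun θ => ψ ‖g (circleMap 0 1 θ)‖ := ψ.continuous_comp_norm.comp hc
  have h3 := ψ.strictConvexOn'.convexOn.map_set_average_le (μ := volume)
    (t := Ioc 0 (2 * Real.pi)) (f := fun θ => ‖g (circleMap 0 1 θ)‖) ψ.continuousOn isClosed_Ici
    (by rw [Real.volume_Ioc]; simpa using Real.pi_pos) measure_Ioc_lt_top.ne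
    (ae_of_all _ fun θ => norm_nonneg _)
    (hc.norm.continuousOn.integrableOn_Icc.mono_set Ioc_subset_Icc_self)
    (hc2.continuousOn.integrableOn_Icc.mono_set Ioc_subset_Icc_self)
  have h4 := ψ.monotoneOn (mem_Ici.2 (norm_nonneg (g 0)))
    (mem_Ici.2 ((norm_nonneg _).trans h2)) h2
  refine (ENNReal.ofReal_le_ofReal (h4.trans h3)).trans (le_of_eq ?_)
  rw [setAverage_eq, hvol, smul_eq_mul, ENNReal.ofReal_mul (by positivity),
    ofReal_integral_eq_lintegral_ofReal
      (hc2.continuousOn.integrableOn_Icc.mono_set Ioc_subset_Icc_self)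
      (ae_of_all _ fun θ => ψ.nonneg' _ (norm_nonneg _))]

end OrliczFunction

/-! ### Sub-mean value property over Bergman regions -/

section SubMeanValue

variable {N : ℕ} {α : ℝ}

local notation "E" => EuclideanSpace ℂ (Fin N)

lemma measurePreserving_smul_of_norm_eq_one {c : ℂ} (hc : ‖c‖ = 1) :
    MeasurePreserving (fun x : E => c • x) := by
  have hc0 : c ≠ 0 := norm_ne_zero_iff.1 (by rw [hc]; exact one_ne_zero)
  let L : E ≃ₗᵢ[ℝ] E :=
    { toFun := fun x => c • x
      invFun := fun x => c⁻¹ • x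
      map_add' := smul_add c
      map_smul' := fun r x => smul_comm c r x
      left_inv := fun x => inv_smul_smul₀ hc0 x
      right_inv := fun x => smul_inv_smul₀ hc0 x
      norm_map' := fun x => by
        change ‖c • x‖ = ‖x‖
        rw [norm_smul, hc, one_mul] }
  exact L.measurePreserving

/-- By complex linearity of `L`, `c ↦ f (w + L (c • y))` is holomorphic on the disc with value `f w`
at 0, so the circle inequality applies for each `y`. Integrating over `y` and exchanging integrals
removes the rotation, because `y ↦ c • y` preserves volume when `|c| = 1`. -/
lemma ofReal_mul_volume_le_lintegral (ψ : OrliczFunction) {f : E → ℂ}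
    (hf : DifferentiableOn ℂ f (cBall N)) (L : E →L[ℂ] E) (w : E) (r : ℝ)
    (hL : ∀ y ∈ Metric.ball (0 : E) r, w + L y ∈ cBall N) :
    ENNReal.ofReal (ψ ‖f w‖) * volume (Metric.ball (0 : E) r)
      ≤ ∫⁻ y in Metric.ball (0 : E) r, ENNReal.ofReal (ψ ‖f (w + L y)‖) := by
  set B := Metric.ball (0 : E) r with hB
  have hBm : MeasurableSet B := measurableSet_ball
  set U : E → ℝ≥0∞ := B.indicator fun y => ENNReal.ofReal (ψ ‖f (w + L y)‖) with hU
  have hUm : Measurable U := by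
    refine ContinuousOn.measurable_indicator ?_ hBm
    refine ENNReal.continuous_ofReal.comp_continuousOn
      (ψ.continuous_comp_norm.comp_continuousOn (hf.continuousOn.comp ?_ hL))
    fun_prop
  have hrot : ∀ {c : ℂ}, ‖c‖ = 1 → ∀ y, c • y ∈ B ↔ y ∈ B := by
    intro c hc y
    rw [hB, mem_ball_zero_iff, mem_ball_zero_iff, norm_smul, hc, one_mul]
  have hcirc : ∀ θ, ‖circleMap 0 1 θ‖ = 1 := by simp
  have hpt : ∀ y, B.indicator (fun _ => ENNReal.ofReal (ψ ‖f w‖)) y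
      ≤ ENNReal.ofReal (2 * Real.pi)⁻¹ *
        ∫⁻ θ in Ioc 0 (2 * Real.pi), U (circleMap 0 1 θ • y) := by
    intro y
    by_cases hy : y ∈ B
    · rw [indicator_of_mem hy]
      have hd : DiffContOnCl ℂ (fun c : ℂ => f (w + L (c • y))) (Metric.ball 0 1) := by
        refine DifferentiableOn.diffContOnCl ?_
        rw [closure_ball _ one_ne_zero]
        refine hf.comp (t := cBall N) (f := fun c : ℂ => w + L (c • y)) ?_ fun c hc => ?_
        · fun_prop
        · refine hL _ ?_
          rw [mem_ball_zero_iff, norm_smul]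
          rw [mem_closedBall_zero_iff] at hc
          rw [hB, mem_ball_zero_iff] at hy
          exact (mul_le_of_le_one_left (norm_nonneg y) hc).trans_lt hy
      have h1 := ψ.ofReal_le_lintegral_circle hd
      simp only [zero_smul, map_zero, add_zero] at h1
      refine h1.trans (le_of_eq ?_)
      congr 1
      refine lintegral_congr fun θ => ?_
      rw [hU, indicator_of_mem ((hrot (hcirc θ) y).2 hy)]
    · rw [indicator_of_notMem hy]
      exact zero_le
  have hjoint : Measurable fun p : E × ℝ => U (circleMap 0 1 p.2 • p.1) := by
    refine hUm.comp ?_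
    have : Continuous fun p : E × ℝ => circleMap 0 1 p.2 • p.1 := by
      have := continuous_circleMap 0 1
      fun_prop
    exact this.measurable
  rw [← lintegral_indicator_const hBm]
  refine (lintegral_mono hpt).trans (le_of_eq ?_)
  rw [lintegral_const_mul' _ _ ENNReal.ofReal_ne_top, lintegral_lintegral_swap hjoint.aemeasurable]
  have h1 : ∀ θ, ∫⁻ y, U (circleMap 0 1 θ • y) = ∫⁻ y, U y := fun θ =>
    (measurePreserving_smul_of_norm_eq_one (hcirc θ)).lintegral_comp hUm
  rw [lintegral_congr h1, setLIntegral_const, Real.volume_Ioc, sub_zero, mul_comm (lintegral _ _),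
    ← mul_assoc, ← ENNReal.ofReal_mul (by positivity), inv_mul_cancel₀ (by positivity),
    ENNReal.ofReal_one, one_mul, hU, lintegral_indicator hBm]

/-- The points of the ball that are at bounded Bergman distance from `z`. -/
def bergmanRegion (z : cBall N) : Set (cBall N) :=
  {w | ‖1 - inner ℂ (z : E) (w : E)‖ < 4 * (1 - ‖(z : E)‖ ^ 2) ∧
    1 - ‖(z : E)‖ ^ 2 < 2 * (1 - ‖(w : E)‖ ^ 2)}

/-- The real arithmetic behind `add_anisotropicDilation_mem`, with `c`, `x` the modulus and real
part of `⟨e, y⟩` and `z`, `q` standing for norms. The perturbation is small enough that `7δ/16 ≤ 1 -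
z² ≤ 3δ/2`, whereas `q ≤ 5δ/4`. -/
lemma bergmanRegion_bounds {ρ δ y c x z q : ℝ} (hρ : 0 ≤ ρ) (hρ1 : ρ < 1) (hδ : δ = 1 - ρ ^ 2)
    (hy0 : 0 ≤ y) (hy : y < 1 / 4) (h0 : 0 ≤ c) (hcy : c ≤ y) (hx : |x| ≤ c)
    (hz : z ^ 2 = ρ ^ 2 + 2 * (ρ * δ * x) + (δ * y ^ 2 + (δ ^ 2 - δ) * c ^ 2))
    (hq : q ≤ δ + ρ * δ * c) :
    z ^ 2 < 1 ∧ q < 4 * (1 - z ^ 2) ∧ 1 - z ^ 2 < 2 * δ := by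
  have hδ0 : 0 < δ := by nlinarith
  have hδ1 : δ ≤ 1 := by nlinarith
  have hre := abs_le.1 hx
  have hρδ : 0 ≤ ρ * δ := by positivity
  have h1 : ρ * δ * c ≤ δ * (1 / 4) := by
    have : ρ * c ≤ 1 * (1 / 4) := mul_le_mul hρ1.le (by linarith) h0 zero_le_one
    nlinarith
  have h2 : ρ * δ * x ≤ ρ * δ * c := mul_le_mul_of_nonneg_left hre.2 hρδ
  have h3 : ρ * δ * -c ≤ ρ * δ * x := mul_le_mul_of_nonneg_left hre.1 hρδ
  have h4 : 0 ≤ (δ - δ ^ 2) * c ^ 2 := mul_nonneg (by nlinarith) (sq_nonneg c)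
  have h5 : y ^ 2 ≤ 1 / 16 := by nlinarith
  have h6 : δ * c ^ 2 ≤ δ * y ^ 2 := by gcongr
  have h7 : δ * y ^ 2 ≤ δ * (1 / 16) := mul_le_mul_of_nonneg_left h5 hδ0.le
  have h8 : 0 ≤ δ ^ 2 * c ^ 2 := by positivity
  have hlow : δ * (7 / 16) ≤ 1 - z ^ 2 := by rw [hz]; linarith
  exact ⟨by linarith, by linarith, by rw [hz]; linarith⟩

/-- The dilation with parameter `1 - |w|²` carries the ball of radius `1/4` to an ellipsoid around
`w`, of the shape of a Bergman ball. Each of its points `z` has `w` in its Bergman region, which is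
the order of the roles that Tonelli's theorem later needs. -/
lemma add_anisotropicDilation_mem {w e y : E} {ρ : ℝ} (hρ : 0 ≤ ρ) (hρ1 : ρ < 1) (he : ‖e‖ = 1)
    (hw : w = (ρ : ℂ) • e) (hy : ‖y‖ < 1 / 4) {z : E}
    (hz : z = w + anisotropicDilation e (1 - ‖w‖ ^ 2) y) :
    ‖z‖ < 1 ∧ ‖1 - inner ℂ z w‖ < 4 * (1 - ‖z‖ ^ 2) ∧ 1 - ‖z‖ ^ 2 < 2 * (1 - ‖w‖ ^ 2) := by
  have hwn : ‖w‖ = ρ := by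
    rw [hw, norm_smul, he, Complex.norm_real, Real.norm_of_nonneg hρ, mul_one]
  rw [hwn] at hz ⊢
  set δ := 1 - ρ ^ 2 with hδ
  have hδ0 : 0 < δ := by nlinarith
  have hδ1 : δ ≤ 1 := by nlinarith
  set c := inner ℂ e y with hc
  have hcy : ‖c‖ ≤ ‖y‖ := by
    have := norm_inner_le_norm (𝕜 := ℂ) e y
    rwa [he, one_mul] at this
  have hwA : inner ℂ w (anisotropicDilation e δ y) = ((ρ * δ : ℝ) : ℂ) * c := by
    rw [hw, inner_smul_left, inner_anisotropicDilation he, Complex.conj_ofReal]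
    push_cast; ring
  have hzn : ‖z‖ ^ 2 = ρ ^ 2 + 2 * (ρ * δ * c.re) + (δ * ‖y‖ ^ 2 + (δ ^ 2 - δ) * ‖c‖ ^ 2) := by
    rw [hz, @norm_add_sq ℂ, norm_sq_anisotropicDilation he hδ0.le, hwA, hwn]
    have : RCLike.re (((ρ * δ : ℝ) : ℂ) * c) = ρ * δ * c.re := Complex.re_ofReal_mul _ _
    rw [this]
  have hzw : ‖1 - inner ℂ z w‖ ≤ δ + ρ * δ * ‖c‖ := by
    rw [← inner_conj_symm, hz, inner_add_right, hwA, inner_self_eq_norm_sq_to_K, hwn]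
    have : 1 - (starRingEnd ℂ) (((ρ : ℝ) : ℂ) ^ 2 + ((ρ * δ : ℝ) : ℂ) * c)
        = ((δ : ℝ) : ℂ) - ((ρ * δ : ℝ) : ℂ) * (starRingEnd ℂ) c := by
      rw [map_add, map_mul, map_pow, Complex.conj_ofReal, Complex.conj_ofReal, hδ]
      push_cast; ring
    refine (congrArg norm this).le.trans ((norm_sub_le _ _).trans (le_of_eq ?_))
    rw [norm_mul, RCLike.norm_conj, Complex.norm_real, Complex.norm_real,
      Real.norm_of_nonneg hδ0.le, Real.norm_of_nonneg (by positivity)]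
  obtain ⟨h1, h2, h3⟩ := bergmanRegion_bounds hρ hρ1 hδ (norm_nonneg y) hy (norm_nonneg c) hcy
    (Complex.abs_re_le_norm c) hzn hzw
  exact ⟨by nlinarith [norm_nonneg z], h2, h3⟩

/-- The sub-mean value property of `ψ(|f|)` over Bergman balls. -/
lemma exists_ofReal_le_lintegral_bergmanRegion (hN : 1 ≤ N) (hα : -1 < α) :
    ∃ C : ℝ≥0∞, C ≠ ∞ ∧ ∀ (ψ : OrliczFunction) (f : cBall N → ℂ), HolomorphicOnBall f →
      ∀ w : cBall N, ENNReal.ofReal (ψ ‖f w‖) ≤ C * ∫⁻ z in {z | w ∈ bergmanRegion z},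
        ENNReal.ofReal ((1 - ‖(z : E)‖ ^ 2) ^ (-(N + 1 + α))) * ENNReal.ofReal (ψ ‖f z‖)
          ∂(weightedVolume N α) := by
  set V := volume (Metric.ball (0 : E) (1 / 4)) with hV
  have hV0 : V ≠ 0 := (Metric.measure_ball_pos _ _ (by norm_num)).ne'
  have hVt : V ≠ ∞ := measure_ball_lt_top.ne
  have hW0 := weightFactor_ne_zero (N := N) hα
  have hWt := weightFactor_ne_top (N := N) (α := α)
  refine ⟨V⁻¹ * ((weightFactor N α)⁻¹ * ENNReal.ofReal (2 ^ (N + 1))), ?_, ?_⟩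
  · exact ENNReal.mul_ne_top (ENNReal.inv_ne_top.2 hV0)
      (ENNReal.mul_ne_top (ENNReal.inv_ne_top.2 hW0) ENNReal.ofReal_ne_top)
  rintro ψ f hfh w
  have hfc := hfh.continuous
  obtain ⟨F, hF, hFf⟩ := hfh
  -- At `w = 0` any unit vector serves; one exists because `N ≥ 1`.
  obtain ⟨ρ, e, hρ, hρ1, he, hw⟩ : ∃ (ρ : ℝ) (e : E), 0 ≤ ρ ∧ ρ < 1 ∧ ‖e‖ = 1 ∧
      (w : E) = (ρ : ℂ) • e := by
    have hw1 := mem_ball_zero_iff.1 w.2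
    rcases eq_or_ne (w : E) 0 with h | h
    · refine ⟨0, EuclideanSpace.single ⟨0, hN⟩ 1, le_rfl, one_pos, by simp, by simp [h]⟩
    · refine ⟨‖(w : E)‖, ((‖(w : E)‖⁻¹ : ℝ) : ℂ) • (w : E), norm_nonneg _, hw1, ?_, ?_⟩
      · rw [norm_smul, Complex.norm_real, norm_inv, norm_norm, inv_mul_cancel₀ (norm_ne_zero_iff.2 h)]
      · rw [smul_smul, ← Complex.ofReal_mul, mul_inv_cancel₀ (norm_ne_zero_iff.2 h),
          Complex.ofReal_one, one_smul]
  set δ := 1 - ‖(w : E)‖ ^ 2 with hδ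
  have hδ0 : 0 < δ := one_sub_sq_pos w
  set A := anisotropicDilation e δ with hA
  set S : Set E := {z | ‖z‖ < 1 ∧ ‖1 - inner ℂ z (w : E)‖ < 4 * (1 - ‖z‖ ^ 2) ∧
    1 - ‖z‖ ^ 2 < 2 * δ} with hS
  have hSm : MeasurableSet S := by
    have h1 : Continuous fun z : E => ‖1 - inner ℂ z (w : E)‖ := by fun_prop
    have h2 : Continuous fun z : E => 4 * (1 - ‖z‖ ^ 2) := by fun_prop
    have h3 : Continuous fun z : E => 1 - ‖z‖ ^ 2 := by fun_prop
    exact (isOpen_lt continuous_norm continuous_const).measurableSet.inter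
      ((isOpen_lt h1 h2).measurableSet.inter (isOpen_lt h3 continuous_const).measurableSet)
  have hSB : S ⊆ cBall N := fun z hz => mem_ball_zero_iff.2 hz.1
  have hmem : ∀ y ∈ Metric.ball (0 : E) (1 / 4), (w : E) + A y ∈ S := fun y hy =>
    add_anisotropicDilation_mem hρ hρ1 he hw (mem_ball_zero_iff.1 hy) rfl
  set H : E → ℝ≥0∞ := S.indicator fun z => ENNReal.ofReal (ψ ‖F z‖) with hH
  have hHm : Measurable H := by
    refine ContinuousOn.measurable_indicator ?_ hSm
    exact ENNReal.continuous_ofReal.comp_continuousOn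
      (ψ.continuous_comp_norm.comp_continuousOn (hF.continuousOn.mono hSB))
  have h1 := ofReal_mul_volume_le_lintegral ψ hF A w (1 / 4) fun y hy => hSB (hmem y hy)
  rw [hFf] at h1
  have h2 : ∫⁻ y in Metric.ball (0 : E) (1 / 4), ENNReal.ofReal (ψ ‖F ((w : E) + A y)‖)
      ≤ ENNReal.ofReal ((δ ^ (N + 1))⁻¹) * ∫⁻ z, H z := by
    calc ∫⁻ y in Metric.ball (0 : E) (1 / 4), ENNReal.ofReal (ψ ‖F ((w : E) + A y)‖)
        = ∫⁻ y in Metric.ball (0 : E) (1 / 4), H ((w : E) + A y) := by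
          refine setLIntegral_congr_fun measurableSet_ball fun y hy => ?_
          rw [hH]
          exact (indicator_of_mem (hmem y hy) (fun z => ENNReal.ofReal (ψ ‖F z‖))).symm
      _ ≤ ∫⁻ y, H ((w : E) + A y) := setLIntegral_le_lintegral _ _
      _ = ∫⁻ x, H ((w : E) + x) ∂(Measure.map A volume) :=
          (lintegral_map (hHm.comp (measurable_const_add _)) A.continuous.measurable).symm
      _ = _ := by
          rw [hA, map_anisotropicDilation he hδ0, lintegral_smul_measure,
            lintegral_add_left_eq_self, smul_eq_mul]
  set g : E → ℝ≥0∞ := S.indicator fun z =>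
    ENNReal.ofReal ((1 - ‖z‖ ^ 2) ^ (-(N + 1 + α))) * ENNReal.ofReal (ψ ‖F z‖) with hg
  -- The two powers of `1 - |z|²` combine to the exponent `-(N + 1)`, and `1 - |z|² < 2 * δ` on `S`
  -- compares this with the Jacobian at the cost of `2 ^ (N + 1)`.
  have h3 : ENNReal.ofReal ((δ ^ (N + 1))⁻¹) * ∫⁻ z, H z ≤ ENNReal.ofReal (2 ^ (N + 1)) *
      ∫⁻ z in cBall N, ENNReal.ofReal ((1 - ‖z‖ ^ 2) ^ α) * g z := by
    rw [← lintegral_const_mul' _ _ ENNReal.ofReal_ne_top,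
      ← lintegral_const_mul' _ _ ENNReal.ofReal_ne_top, ← lintegral_indicator measurableSet_ball]
    refine lintegral_mono fun z => ?_
    by_cases hz : z ∈ S
    · rw [indicator_of_mem (hSB hz), hH, hg, indicator_of_mem hz, indicator_of_mem hz, ← mul_assoc,
        ← mul_assoc]
      have hz1 : 0 < 1 - ‖z‖ ^ 2 := by
        nlinarith [norm_nonneg z, hz.1]
      rw [mul_assoc (ENNReal.ofReal (2 ^ (N + 1))),
        ← ENNReal.ofReal_mul (Real.rpow_nonneg hz1.le _), ← Real.rpow_add hz1,
        ← ENNReal.ofReal_mul (p := 2 ^ (N + 1)) (by positivity)]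
      refine mul_le_mul_left (ENNReal.ofReal_le_ofReal ?_) _
      have h4 : (1 - ‖z‖ ^ 2) ^ (α + -(N + 1 + α)) = ((1 - ‖z‖ ^ 2) ^ (N + 1))⁻¹ := by
        rw [show α + -((N : ℝ) + 1 + α) = -((N + 1 : ℕ) : ℝ) by push_cast; ring,
          Real.rpow_neg hz1.le, Real.rpow_natCast]
      rw [h4, ← div_eq_mul_inv, le_div_iff₀ (by positivity), inv_mul_le_iff₀ (by positivity),
        ← mul_pow, mul_comm δ]
      exact pow_le_pow_left₀ hz1.le hz.2.2.le _
    · rw [hH, indicator_of_notMem hz, mul_zero]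
      exact zero_le
  have hSsub : {z | w ∈ bergmanRegion z} = (Subtype.val ⁻¹' S : Set (cBall N)) := by
    ext z
    exact ⟨fun hz => ⟨mem_ball_zero_iff.1 z.2, hz⟩, fun hz => hz.2⟩
  have hSm' : MeasurableSet (Subtype.val ⁻¹' S : Set (cBall N)) := measurable_subtype_coe hSm
  have hgeq : ∀ z : cBall N, g z = (Subtype.val ⁻¹' S : Set (cBall N)).indicator (fun z =>
      ENNReal.ofReal ((1 - ‖(z : E)‖ ^ 2) ^ (-(N + 1 + α))) * ENNReal.ofReal (ψ ‖f z‖)) z := by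
    intro z
    by_cases hz : (z : E) ∈ S
    · have hz' : z ∈ (Subtype.val ⁻¹' S : Set (cBall N)) := hz
      rw [hg, indicator_of_mem hz, indicator_of_mem hz', hFf]
    · have hz' : z ∉ (Subtype.val ⁻¹' S : Set (cBall N)) := hz
      rw [hg, indicator_of_notMem hz, indicator_of_notMem hz']
  have hgm : Measurable fun z : cBall N => g z := by
    rw [funext hgeq]
    refine Measurable.indicator ?_ hSm'
    have := (ψ.continuous_comp_norm.comp hfc).measurable
    exact Measurable.mul (by fun_prop) this.ennreal_ofReal
  have h4 := lintegral_weightedVolume hα hgm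
  rw [lintegral_congr hgeq, lintegral_indicator hSm', ← hSsub] at h4
  rw [h4]
  have h5 := h1.trans (h2.trans h3)
  rw [mul_comm, ENNReal.mul_le_iff_le_inv hV0 hVt] at h5
  refine h5.trans (le_of_eq ?_)
  rw [mul_assoc, mul_comm (weightFactor N α)⁻¹, mul_assoc, ← mul_assoc (weightFactor N α)⁻¹,
    ENNReal.inv_mul_cancel hW0 hWt, one_mul]

end SubMeanValue

/-! ### The Carleson embedding -/

section Embedding

variable {N : ℕ} {α : ℝ}

local notation "E" => EuclideanSpace ℂ (Fin N)

lemma isOpen_bergmanRegion : IsOpen {p : cBall N × cBall N | p.1 ∈ bergmanRegion p.2} := by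
  have h1 : Continuous fun p : cBall N × cBall N => ‖1 - inner ℂ (p.2 : E) (p.1 : E)‖ := by
    fun_prop
  have h2 : Continuous fun p : cBall N × cBall N => 4 * (1 - ‖(p.2 : E)‖ ^ 2) := by fun_prop
  have h3 : Continuous fun p : cBall N × cBall N => 1 - ‖(p.2 : E)‖ ^ 2 := by fun_prop
  have h4 : Continuous fun p : cBall N × cBall N => 2 * (1 - ‖(p.1 : E)‖ ^ 2) := by fun_prop
  exact (isOpen_lt h1 h2).inter (isOpen_lt h3 h4)

lemma measurableSet_bergmanRegion (z : cBall N) : MeasurableSet (bergmanRegion z) :=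
  (isOpen_bergmanRegion.preimage (by fun_prop : Continuous fun w : cBall N => (w, z))).measurableSet

lemma measurableSet_mem_bergmanRegion (w : cBall N) :
    MeasurableSet {z | w ∈ bergmanRegion z} :=
  (isOpen_bergmanRegion.preimage (by fun_prop : Continuous fun z : cBall N => (w, z))).measurableSet

lemma HolomorphicOnBall.const_smul {f : cBall N → ℂ} (hf : HolomorphicOnBall f) (c : ℂ) :
    HolomorphicOnBall (c • f) := by
  obtain ⟨F, hF, hFf⟩ := hf
  exact ⟨c • F, hF.const_smul c, fun z => by simp [hFf]⟩

lemma orliczModular_eq_lintegral {Ω : Type*} [MeasurableSpace Ω] (ψ : OrliczFunction)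
    (μ : Measure Ω) (f : Ω → ℂ) {R : ℝ} (hR : 0 < R) :
    orliczModular ψ μ f R = ∫⁻ z, ENNReal.ofReal (ψ ‖(((R⁻¹ : ℝ) : ℂ) • f) z‖) ∂μ := by
  refine lintegral_congr fun z => ?_
  rw [Pi.smul_apply, norm_smul, Complex.norm_real, Real.norm_of_nonneg (by positivity),
    inv_mul_eq_div]

/-- The Carleson embedding theorem, for all Orlicz functions at once. -/
lemma exists_orliczModular_le_of_carleson (hN : 1 ≤ N) (hα : -1 < α) :
    ∃ C : ℝ≥0∞, C ≠ ∞ ∧ ∀ (μ : Measure (cBall N)) [SFinite μ] (κ : ℝ≥0∞),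
      (∀ z : cBall N,
        μ (bergmanRegion z) ≤ κ * ENNReal.ofReal ((1 - ‖(z : E)‖ ^ 2) ^ (N + 1 + α))) →
      ∀ (ψ : OrliczFunction) (f : cBall N → ℂ), HolomorphicOnBall f → ∀ R, 0 < R →
        orliczModular ψ μ f R ≤ C * κ * orliczModular ψ (weightedVolume N α) f R := by
  obtain ⟨C, hC, h⟩ := exists_ofReal_le_lintegral_bergmanRegion hN hα
  have := isFiniteMeasure_weightedVolume hN hα
  refine ⟨C, hC, fun μ _ κ hμ ψ f₀ hf₀ R hR => ?_⟩
  rw [orliczModular_eq_lintegral _ _ _ hR, orliczModular_eq_lintegral _ _ _ hR]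
  set f := ((R⁻¹ : ℝ) : ℂ) • f₀
  have hf : HolomorphicOnBall f := hf₀.const_smul _
  set G : cBall N → ℝ≥0∞ := fun z =>
    ENNReal.ofReal ((1 - ‖(z : E)‖ ^ 2) ^ (-(N + 1 + α))) * ENNReal.ofReal (ψ ‖f z‖) with hG
  have hGm : Measurable G := by
    have := (ψ.continuous_comp_norm.comp hf.continuous).measurable
    exact Measurable.mul (by fun_prop) this.ennreal_ofReal
  set S : Set (cBall N × cBall N) := {p | p.1 ∈ bergmanRegion p.2} with hS
  have hSm : MeasurableSet S := isOpen_bergmanRegion.measurableSet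
  have hjoint : Measurable fun p : cBall N × cBall N => S.indicator (fun p => G p.2) p :=
    (hGm.comp measurable_snd).indicator hSm
  calc ∫⁻ w, ENNReal.ofReal (ψ ‖f w‖) ∂μ
      ≤ ∫⁻ w, C * ∫⁻ z, S.indicator (fun p => G p.2) (w, z) ∂(weightedVolume N α) ∂μ := by
        refine lintegral_mono fun w => (h ψ f hf w).trans (le_of_eq ?_)
        congr 1
        rw [← lintegral_indicator (measurableSet_mem_bergmanRegion w)]
        rfl
    _ = C * ∫⁻ z, ∫⁻ w, S.indicator (fun p => G p.2) (w, z) ∂μ ∂(weightedVolume N α) := by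
        rw [lintegral_const_mul' _ _ hC, lintegral_lintegral_swap hjoint.aemeasurable]
    -- The inner integral is `G z` times the `μ`-mass of `bergmanRegion z`; the Carleson bound
    -- cancels the negative power in `G`.
    _ ≤ C * ∫⁻ z, κ * ENNReal.ofReal (ψ ‖f z‖) ∂(weightedVolume N α) := by
        refine mul_le_mul_right (lintegral_mono fun z => ?_) C
        have h1 : ∀ w, S.indicator (fun p => G p.2) (w, z)
            = (bergmanRegion z).indicator (fun _ => G z) w := fun w => rfl
        have hz := one_sub_sq_pos z
        rw [lintegral_congr h1, lintegral_indicator_const (measurableSet_bergmanRegion z), hG]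
        calc ENNReal.ofReal ((1 - ‖(z : E)‖ ^ 2) ^ (-(N + 1 + α))) * ENNReal.ofReal (ψ ‖f z‖)
              * μ (bergmanRegion z)
            ≤ ENNReal.ofReal ((1 - ‖(z : E)‖ ^ 2) ^ (-(N + 1 + α))) * ENNReal.ofReal (ψ ‖f z‖)
              * (κ * ENNReal.ofReal ((1 - ‖(z : E)‖ ^ 2) ^ (N + 1 + α))) :=
              mul_le_mul_right (hμ z) _
          _ = κ * ENNReal.ofReal (ψ ‖f z‖) * (ENNReal.ofReal ((1 - ‖(z : E)‖ ^ 2) ^ (-(N + 1 + α)))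
              * ENNReal.ofReal ((1 - ‖(z : E)‖ ^ 2) ^ (N + 1 + α))) := by ring
          _ = κ * ENNReal.ofReal (ψ ‖f z‖) := by
            rw [← ENNReal.ofReal_mul (Real.rpow_nonneg hz.le _), ← Real.rpow_add hz,
              neg_add_cancel, Real.rpow_zero, ENNReal.ofReal_one, mul_one]
    _ = _ := by
        have h1 : Measurable fun z => ψ ‖f z‖ :=
          (ψ.continuous_comp_norm.comp hf.continuous).measurable
        rw [lintegral_const_mul _ h1.ennreal_ofReal, mul_assoc]

end Embedding

/-! ### Passing between modular and norm -/

section Luxemburg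

variable {Ω : Type*} [MeasurableSpace Ω] {ψ : OrliczFunction} {μ : Measure Ω} {f : Ω → ℂ}

/-- By convexity, enlarging the scale by `K ≥ 1` divides the modular by at least `K`. A constant in
a modular inequality thus becomes a constant in the norm, for every Orlicz function. -/
lemma luxemburgNorm_le_mul {R K : ℝ} (hR : 0 < R) (hK : 1 ≤ K)
    (h : orliczModular ψ μ f R ≤ ENNReal.ofReal K) : luxemburgNorm ψ μ f ≤ K * R := by
  have hK0 : 0 < K := by linarith
  refine csInf_le luxemburg_bddBelow ⟨by positivity, ?_⟩
  have h1 := orliczModular_div_le (ψ := ψ) (μ := μ) (f := f) (t := K⁻¹) hR (by positivity)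
    (inv_le_one_of_one_le₀ hK)
  rw [div_inv_eq_mul, mul_comm R] at h1
  refine h1.trans ((mul_le_mul_right h _).trans (le_of_eq ?_))
  rw [← ENNReal.ofReal_mul (by positivity), inv_mul_cancel₀ hK0.ne', ENNReal.ofReal_one]

lemma orliczModular_le_one_of_lt (hf : MemOrlicz ψ μ f) {R : ℝ} (hR : luxemburgNorm ψ μ f < R) :
    orliczModular ψ μ f R ≤ 1 := by
  obtain ⟨C, ⟨hC, hfC⟩, hCR⟩ := exists_lt_of_csInf_lt hf.nonempty hR
  exact (orliczModular_anti hC hCR.le).trans hfC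

end Luxemburg

/-! ### Point evaluations and test functions -/

namespace BergmanOrlicz

variable {N : ℕ} {α : ℝ} {ψ : OrliczFunction}

local notation "E" => EuclideanSpace ℂ (Fin N)

lemma orliczModular_le_one [Fact (-1 < α)] (f : BergmanOrlicz N α ψ) {R : ℝ} (hR : ‖f‖ < R) :
    orliczModular ψ (weightedVolume N α) f R ≤ 1 :=
  orliczModular_le_one_of_lt f.2.2 hR

/-- Point evaluations are bounded, locally uniformly in the ball. -/
lemma exists_norm_apply_le (hN : 1 ≤ N) [hα : Fact (-1 < α)] (ψ : OrliczFunction) {s : ℝ}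
    (hs : 0 < s) : ∃ X, 0 ≤ X ∧ ∀ w : cBall N, s ≤ 1 - ‖(w : E)‖ ^ 2 →
      ∀ f : BergmanOrlicz N α ψ, ‖f w‖ ≤ X * ‖f‖ := by
  obtain ⟨C, hC, h⟩ := exists_ofReal_le_lintegral_bergmanRegion hN hα.out
  have hn : 0 ≤ N + 1 + α := by
    have := hα.out
    have : (0 : ℝ) ≤ N := N.cast_nonneg
    linarith
  -- If `w ∈ bergmanRegion z`, then `s / 2 ≤ |1 - ⟨z, w⟩| < 4 (1 - |z|²)`, hence `1 - |z|² > s / 8`.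
  set D : ℝ≥0∞ := C * ENNReal.ofReal ((s / 8) ^ (-(N + 1 + α))) with hD
  have hDt : D ≠ ∞ := ENNReal.mul_ne_top hC ENNReal.ofReal_ne_top
  -- With `ψ X` strictly above `D`, monotonicity alone turns `ψ (|f w| / R) ≤ D` into `|f w| ≤ X *
  -- R`.
  obtain ⟨X, hX0, hX⟩ := ψ.exists_eq (y := D.toReal + 1) (by positivity)
  refine ⟨X, hX0, fun w hw f => ?_⟩
  have key : ∀ R, ‖f‖ < R → ‖f w‖ ≤ X * R := by
    intro R hR
    have hR0 : 0 < R := (norm_nonneg f).trans_lt hR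
    have h1 := h ψ (((R⁻¹ : ℝ) : ℂ) • f.1) (f.2.1.const_smul _) w
    have h2 : ∫⁻ z in {z | w ∈ bergmanRegion z},
        ENNReal.ofReal ((1 - ‖(z : E)‖ ^ 2) ^ (-(N + 1 + α)))
          * ENNReal.ofReal (ψ ‖(((R⁻¹ : ℝ) : ℂ) • f.1) z‖) ∂(weightedVolume N α)
        ≤ ENNReal.ofReal ((s / 8) ^ (-(N + 1 + α))) := by
      calc _ ≤ ∫⁻ z in {z | w ∈ bergmanRegion z}, ENNReal.ofReal ((s / 8) ^ (-(N + 1 + α)))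
          * ENNReal.ofReal (ψ ‖(((R⁻¹ : ℝ) : ℂ) • f.1) z‖) ∂(weightedVolume N α) := by
            refine setLIntegral_mono' (measurableSet_mem_bergmanRegion w) fun z hz => ?_
            refine mul_le_mul_left (ENNReal.ofReal_le_ofReal ?_) _
            have h3 := half_one_sub_sq_le_norm_one_sub_inner w z
            have h4 := hz.1
            rw [← inner_conj_symm, ← map_one (starRingEnd ℂ), ← map_sub, RCLike.norm_conj] at h4
            exact Real.rpow_le_rpow_of_nonpos (by positivity) (by linarith) (by linarith)
        _ ≤ ENNReal.ofReal ((s / 8) ^ (-(N + 1 + α))) * 1 := by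
            rw [lintegral_const_mul' _ _ ENNReal.ofReal_ne_top]
            refine mul_le_mul_right ((setLIntegral_le_lintegral _ _).trans ?_) _
            rw [← orliczModular_eq_lintegral _ _ _ hR0]
            exact f.orliczModular_le_one hR
        _ = _ := mul_one _
    have h3 := h1.trans (mul_le_mul_right h2 C)
    rw [← hD, ENNReal.ofReal_le_iff_le_toReal hDt, Pi.smul_apply, norm_smul, Complex.norm_real,
      Real.norm_of_nonneg (by positivity), inv_mul_eq_div] at h3
    by_contra! hlt
    rw [← lt_div_iff₀ hR0] at hlt
    have h4 := ψ.monotoneOn (mem_Ici.2 hX0) (mem_Ici.2 (hX0.trans hlt.le)) hlt.le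
    rw [hX] at h4
    change ψ (‖f w‖ / R) ≤ _ at h3
    linarith
  have hlim : Tendsto (fun R => X * R) (𝓝[>] ‖f‖) (𝓝 (X * ‖f‖)) :=
    (continuous_const_mul X).continuousAt.tendsto.mono_left nhdsWithin_le_nhds
  refine ge_of_tendsto hlim ?_
  filter_upwards [self_mem_nhdsWithin] with R hR using key R hR

lemma exists_norm_apply_le_mul_norm (hN : 1 ≤ N) [hα : Fact (-1 < α)] (ψ : OrliczFunction)
    (w : cBall N) : ∃ X, 0 ≤ X ∧ ∀ f : BergmanOrlicz N α ψ, ‖f w‖ ≤ X * ‖f‖ := by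
  obtain ⟨X, hX, h⟩ := exists_norm_apply_le (α := α) hN ψ (one_sub_sq_pos w)
  exact ⟨X, hX, h w le_rfl⟩

lemma tendsto_apply (hN : 1 ≤ N) [hα : Fact (-1 < α)] {ι : Type*} {l : Filter ι}
    {f : ι → BergmanOrlicz N α ψ} {g : BergmanOrlicz N α ψ} (h : Tendsto f l (𝓝 g))
    (w : cBall N) : Tendsto (fun i => f i w) l (𝓝 (g w)) := by
  obtain ⟨X, hX, hle⟩ := exists_norm_apply_le_mul_norm (α := α) hN ψ w
  rw [tendsto_iff_norm_sub_tendsto_zero] at h ⊢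
  have h1 := h.const_mul X
  rw [mul_zero] at h1
  exact squeeze_zero (fun i => norm_nonneg _) (fun i => hle (f i - g)) h1

/-- Test functions: normalized powers of the kernel `(1 - |a|²) / (1 - ⟨z, a⟩)`. -/
lemma exists_test_function (hN : 1 ≤ N) [hα : Fact (-1 < α)] (ψ : OrliczFunction) :
    ∃ (m : ℕ) (C : ℝ), N + 2 + α ≤ m ∧ ∀ a : cBall N, ∃ M, 0 ≤ M ∧
      ψ M = (1 - ‖(a : E)‖ ^ 2) ^ (-(N + 1 + α)) ∧ ∃ g : BergmanOrlicz N α ψ, ‖g‖ ≤ C ∧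
        ∀ z : cBall N, ‖g z‖ =
          M / 2 ^ m * ((1 - ‖(a : E)‖ ^ 2) / ‖1 - inner ℂ (a : E) (z : E)‖) ^ m := by
  obtain ⟨m, hm⟩ := exists_nat_ge (N + 2 + α)
  obtain ⟨C, hC, h⟩ := exists_lintegral_kernel_le hN hα.out hm
  refine ⟨m, max C.toReal 1, hm, fun a => ?_⟩
  set δ := 1 - ‖(a : E)‖ ^ 2 with hδ
  have hδ0 : 0 < δ := one_sub_sq_pos a
  -- `ψ M` is the reciprocal of the order of the kernel integral, so that the modular of the test
  -- function stays bounded.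
  obtain ⟨M, hM0, hM⟩ := ψ.exists_eq (y := δ ^ (-(N + 1 + α))) (by positivity)
  refine ⟨M, hM0, hM, ?_⟩
  set G : E → ℂ := fun z => ((M / 2 ^ m : ℝ) : ℂ) * (((δ : ℝ) : ℂ) / (1 - inner ℂ (a : E) z)) ^ m
    with hG
  have hne : ∀ z : cBall N, 0 < ‖1 - inner ℂ (a : E) (z : E)‖ := fun z =>
    lt_of_lt_of_le (half_pos hδ0) (half_one_sub_sq_le_norm_one_sub_inner a z)
  have hGh : DifferentiableOn ℂ G (cBall N) := by
    have h1 : Differentiable ℂ fun z : E => 1 - inner ℂ (a : E) z :=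
      (differentiable_const 1).sub (innerSL ℂ (a : E)).differentiable
    have h2 : DifferentiableOn ℂ (fun z : E => ((δ : ℝ) : ℂ) / (1 - inner ℂ (a : E) z))
        (cBall N) := by
      simp only [div_eq_mul_inv]
      exact (h1.differentiableOn.inv fun z hz => norm_pos_iff.1 (hne ⟨z, hz⟩)).const_mul _
    exact (h2.fun_pow m).const_mul _
  have hGn : ∀ z : cBall N, ‖G z‖ = M / 2 ^ m * (δ / ‖1 - inner ℂ (a : E) (z : E)‖) ^ m := by
    intro z
    have h1 : 0 ≤ M / 2 ^ m := by positivity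
    rw [hG]
    simp only [norm_mul, norm_pow, norm_div, Complex.norm_real, Real.norm_of_nonneg hδ0.le,
      Real.norm_of_nonneg h1]
  have hGhol : HolomorphicOnBall fun z : cBall N => G z := ⟨G, hGh, fun z => rfl⟩
  have hmod : orliczModular ψ (weightedVolume N α) (fun z => G z) 1
      ≤ ENNReal.ofReal (max C.toReal 1) := by
    -- As `δ / q ≤ 2`, the factor `(δ / q) ^ m / 2 ^ m` is at most 1 and convexity takes it out of
    -- `ψ`. What remains is linear in the kernel power.
    have hpt : ∀ z : cBall N, ENNReal.ofReal (ψ (‖G z‖ / 1)) ≤ ENNReal.ofReal (ψ M)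
        * ENNReal.ofReal ((δ / ‖1 - inner ℂ (a : E) (z : E)‖) ^ m) := by
      intro z
      have h1 := half_one_sub_sq_le_norm_one_sub_inner a z
      set q := ‖1 - inner ℂ (a : E) (z : E)‖ with hq
      have hq0 : 0 < q := hne z
      have h2 : δ / q ≤ 2 := by
        rw [div_le_iff₀ hq0]; linarith
      have h3 : (δ / q) ^ m ≤ 2 ^ m := pow_le_pow_left₀ (by positivity) h2 m
      rw [← ENNReal.ofReal_mul (ψ.nonneg' M hM0)]
      refine ENNReal.ofReal_le_ofReal ?_
      rw [div_one, hGn z, show M / 2 ^ m * (δ / q) ^ m = ((δ / q) ^ m / 2 ^ m) * M by ring]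
      refine (ψ.scale_le (by positivity) ((div_le_one (by positivity)).2 h3) hM0).trans ?_
      rw [mul_comm]
      refine mul_le_mul_of_nonneg_left (div_le_self (by positivity) ?_) (ψ.nonneg' M hM0)
      exact one_le_pow₀ (by norm_num)
    refine (lintegral_mono hpt).trans ?_
    rw [lintegral_const_mul' _ _ ENNReal.ofReal_ne_top]
    refine (mul_le_mul_right (h a) _).trans ?_
    rw [hM, mul_left_comm, ← ENNReal.ofReal_mul (by positivity), ← Real.rpow_add hδ0,
      neg_add_cancel, Real.rpow_zero, ENNReal.ofReal_one, mul_one]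
    exact ENNReal.le_ofReal_iff_toReal_le hC (by positivity) |>.2 (le_max_left _ _)
  refine ⟨⟨fun z => G z, hGhol, hGhol.continuous.aestronglyMeasurable, 1, one_pos,
    hmod.trans_lt ENNReal.ofReal_lt_top⟩, ?_, hGn⟩
  have h1 := luxemburgNorm_le_mul one_pos (le_max_right _ _) hmod
  rwa [mul_one] at h1

end BergmanOrlicz

/-! ### Composition operators and Carleson conditions -/

section Composition

variable {N : ℕ} {α : ℝ}

local notation "E" => EuclideanSpace ℂ (Fin N)

lemma continuous_of_holomorphicOnBall {φ : cBall N → cBall N}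
    (hφ : HolomorphicOnBall fun z => (φ z : E)) : Continuous φ :=
  continuous_induced_rng.2 hφ.continuous

lemma HolomorphicOnBall.comp {f : cBall N → ℂ} (hf : HolomorphicOnBall f) {φ : cBall N → cBall N}
    (hφ : HolomorphicOnBall fun z => (φ z : E)) : HolomorphicOnBall fun z => f (φ z) := by
  obtain ⟨F, hF, hFf⟩ := hf
  obtain ⟨Φ, hΦ, hΦφ⟩ := hφ
  refine ⟨F ∘ Φ, hF.comp hΦ fun z hz => ?_, fun z => ?_⟩
  · have := hΦφ ⟨z, hz⟩
    simp only at this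
    rw [this]
    exact (φ ⟨z, hz⟩).2
  · rw [Function.comp_apply, hΦφ, hFf]

lemma orliczModular_map {ψ : OrliczFunction} {μ : Measure (cBall N)} {f : cBall N → ℂ}
    (hf : Continuous f) {φ : cBall N → cBall N} (hφ : Continuous φ) {R : ℝ} (hR : 0 ≤ R) :
    orliczModular ψ (μ.map φ) f R = orliczModular ψ μ (fun z => f (φ z)) R := by
  refine lintegral_map ?_ hφ.measurable
  have h1 : Continuous fun z => ψ (‖f z‖ / R) :=
    ψ.continuousOn.comp_continuous (by fun_prop) fun z => div_nonneg (norm_nonneg _) hR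
  exact h1.measurable.ennreal_ofReal

/-- If the image measure of `v_α` under `φ` is a Carleson measure, then `C_φ` is bounded on all
weighted Bergman-Orlicz spaces. -/
lemma compositionBounded_of_carleson (hN : 1 ≤ N) [hα : Fact (-1 < α)] {φ : cBall N → cBall N}
    (hφ : HolomorphicOnBall fun z => (φ z : E)) {κ : ℝ≥0∞} (hκ : κ ≠ ∞)
    (h : ∀ z : cBall N, (weightedVolume N α).map φ (bergmanRegion z)
      ≤ κ * ENNReal.ofReal ((1 - ‖(z : E)‖ ^ 2) ^ (N + 1 + α)))
    (ψ : OrliczFunction) : CompositionBounded α ψ φ := by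
  have hφc := continuous_of_holomorphicOnBall hφ
  have := isFiniteMeasure_weightedVolume hN hα.out
  obtain ⟨C, hC, hcar⟩ := exists_orliczModular_le_of_carleson hN hα.out
  have hCκ : C * κ ≠ ∞ := ENNReal.mul_ne_top hC hκ
  set K := max (C * κ).toReal 1 with hK
  have hle : C * κ ≤ ENNReal.ofReal K :=
    (ENNReal.le_ofReal_iff_toReal_le hCκ (by positivity)).2 (le_max_left _ _)
  have hmod : ∀ (f : BergmanOrlicz N α ψ) (R : ℝ), 0 < R →
      orliczModular ψ (weightedVolume N α) (fun z => f (φ z)) R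
        ≤ C * κ * orliczModular ψ (weightedVolume N α) f R := fun f R hR => by
    rw [← orliczModular_map f.2.1.continuous hφc hR.le]
    exact hcar _ κ h ψ f f.2.1 R hR
  have hmem : ∀ f : BergmanOrlicz N α ψ, (fun z => f (φ z)) ∈ bergmanOrliczSubmodule N α ψ := by
    intro f
    obtain ⟨R, hR, hfR⟩ := f.2.2.2
    exact ⟨f.2.1.comp hφ, (f.2.1.comp hφ).continuous.aestronglyMeasurable, R, hR,
      (hmod f R hR).trans_lt (ENNReal.mul_lt_top hCκ.lt_top hfR)⟩
  let T₀ : BergmanOrlicz N α ψ →ₗ[ℂ] BergmanOrlicz N α ψ :=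
    { toFun := fun f => ⟨fun z => f (φ z), hmem f⟩
      map_add' := fun f g => rfl
      map_smul' := fun c f => rfl }
  refine ⟨T₀.mkContinuous K fun f => ?_, fun f z => rfl⟩
  have hlim : Tendsto (fun R => K * R) (𝓝[>] ‖f‖) (𝓝 (K * ‖f‖)) :=
    (continuous_const_mul K).continuousAt.tendsto.mono_left nhdsWithin_le_nhds
  refine ge_of_tendsto hlim ?_
  filter_upwards [self_mem_nhdsWithin] with R hR
  have hR0 : 0 < R := (norm_nonneg f).trans_lt hR
  refine luxemburgNorm_le_mul hR0 (le_max_right _ _) ((hmod f R hR0).trans ?_)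
  exact (mul_le_of_le_one_right' (f.orliczModular_le_one hR)).trans hle

/-- Chebyshev's inequality for a test function composed with `φ`. -/
lemma ofReal_mul_map_bergmanRegion_le_one {ψ : OrliczFunction} {φ : cBall N → cBall N}
    (hφ : Continuous φ) {m : ℕ} {M R : ℝ} (hM : 0 ≤ M) (hR : 0 < R) {a : cBall N}
    {g : cBall N → ℂ} (hg : ∀ z : cBall N, ‖g z‖ =
      M / 2 ^ m * ((1 - ‖(a : E)‖ ^ 2) / ‖1 - inner ℂ (a : E) (z : E)‖) ^ m)
    (h : orliczModular ψ (weightedVolume N α) (fun z => g (φ z)) R ≤ 1) :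
    ENNReal.ofReal (ψ (1 / (8 ^ m * R) * M)) * (weightedVolume N α).map φ (bergmanRegion a) ≤ 1 := by
  have hm := measurableSet_bergmanRegion a
  rw [Measure.map_apply hφ.measurable hm]
  refine le_trans ?_ h
  rw [← lintegral_indicator_const (hφ.measurable hm)]
  refine lintegral_mono fun z => ?_
  by_cases hz : z ∈ φ ⁻¹' bergmanRegion a
  · rw [indicator_of_mem hz]
    refine ENNReal.ofReal_le_ofReal (ψ.monotoneOn (mem_Ici.2 (by positivity))
      (mem_Ici.2 (by positivity)) ?_)
    have ha := one_sub_sq_pos a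
    have h1 := half_one_sub_sq_le_norm_one_sub_inner a (φ z)
    have h2 := hz.1
    rw [hg]
    set q := ‖1 - inner ℂ (a : E) (φ z : E)‖
    have hq : 0 < q := by linarith
    -- On the region `q` is less than four times `1 - |a|²`; together with the normalization `2 ^ m`
    -- this produces `8 ^ m`.
    have h3 : (1 / 4 : ℝ) ^ m ≤ ((1 - ‖(a : E)‖ ^ 2) / q) ^ m := by
      refine pow_le_pow_left₀ (by norm_num) ?_ m
      rw [le_div_iff₀ hq]
      linarith
    calc 1 / (8 ^ m * R) * M = M / 2 ^ m * (1 / 4) ^ m / R := by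
          rw [show (8 : ℝ) = 2 * 4 by norm_num, mul_pow, div_pow, one_pow]
          field_simp
      _ ≤ _ := by gcongr
  · rw [indicator_of_notMem hz]
    exact zero_le

/-- If `C_φ` is bounded on a weighted Bergman-Orlicz space defined by a function satisfying the
`Δ₂`-condition, then the image measure of `v_α` under `φ` is a Carleson measure. -/
lemma exists_carleson_of_compositionBounded (hN : 1 ≤ N) [hα : Fact (-1 < α)]
    {φ : cBall N → cBall N} (hφ : HolomorphicOnBall fun z => (φ z : E)) {ν : OrliczFunction}
    (hν : ν.DeltaTwo) (hb : CompositionBounded α ν φ) :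
    ∃ κ : ℝ≥0∞, κ ≠ ∞ ∧ ∀ z : cBall N, (weightedVolume N α).map φ (bergmanRegion z)
      ≤ κ * ENNReal.ofReal ((1 - ‖(z : E)‖ ^ 2) ^ (N + 1 + α)) := by
  have hφc := continuous_of_holomorphicOnBall hφ
  have := isFiniteMeasure_weightedVolume hN hα.out
  have hfin : IsFiniteMeasure ((weightedVolume N α).map φ) := inferInstance
  obtain ⟨T, hT⟩ := hb
  obtain ⟨m, C, hm, htest⟩ := BergmanOrlicz.exists_test_function (α := α) hN ν
  set R := ‖T‖ * |C| + 1 with hR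
  have hR0 : 0 < R := by positivity
  -- Chebyshev controls only `ν (M / (8 ^ m * R))`; `Δ₂` recovers `ν M`, with a constant independent
  -- of `a`.
  obtain ⟨K, hK, L, hL, hKL⟩ := hν.exists_le_mul_add (t := 1 / (8 ^ m * R)) (by positivity)
  set μ := (weightedVolume N α).map φ with hμ
  refine ⟨ENNReal.ofReal K + ENNReal.ofReal L * μ univ, ?_, fun a => ?_⟩
  · exact ENNReal.add_ne_top.2 ⟨ENNReal.ofReal_ne_top,
      ENNReal.mul_ne_top ENNReal.ofReal_ne_top (measure_ne_top _ _)⟩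
  obtain ⟨M, hM0, hM, g, hgC, hg⟩ := htest a
  have hδ := one_sub_sq_pos a
  have hTg : ‖T g‖ < R := by
    have h1 := T.le_opNorm g
    have h2 : ‖T‖ * ‖g‖ ≤ ‖T‖ * |C| := by
      gcongr; exact hgC.trans (le_abs_self C)
    linarith
  have h1 := (T g).orliczModular_le_one hTg
  rw [show ((T g : BergmanOrlicz N α ν) : cBall N → ℂ) = fun z => g (φ z) from funext (hT g)] at h1
  have h2 := ofReal_mul_map_bergmanRegion_le_one hφc hM0 hR0 hg h1
  have h3 : ENNReal.ofReal (ν M) * μ (bergmanRegion a)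
      ≤ ENNReal.ofReal K + ENNReal.ofReal L * μ univ := by
    calc ENNReal.ofReal (ν M) * μ (bergmanRegion a)
        ≤ ENNReal.ofReal (K * ν (1 / (8 ^ m * R) * M) + L) * μ (bergmanRegion a) := by
          gcongr; exact hKL M hM0
      _ = ENNReal.ofReal K * (ENNReal.ofReal (ν (1 / (8 ^ m * R) * M)) * μ (bergmanRegion a))
          + ENNReal.ofReal L * μ (bergmanRegion a) := by
          rw [ENNReal.ofReal_add (mul_nonneg hK (ν.nonneg' _ (by positivity))) hL,
            ENNReal.ofReal_mul hK]
          ring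
      _ ≤ ENNReal.ofReal K * 1 + ENNReal.ofReal L * μ univ := by
          gcongr
          exact subset_univ _
      _ = _ := by rw [mul_one]
  rw [hM] at h3
  calc μ (bergmanRegion a)
      = ENNReal.ofReal ((1 - ‖(a : E)‖ ^ 2) ^ (-(N + 1 + α))) * μ (bergmanRegion a)
        * ENNReal.ofReal ((1 - ‖(a : E)‖ ^ 2) ^ (N + 1 + α)) := by
        rw [mul_right_comm, ← ENNReal.ofReal_mul (by positivity), ← Real.rpow_add hδ,
          neg_add_cancel, Real.rpow_zero, ENNReal.ofReal_one, one_mul]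
    _ ≤ _ := mul_le_mul_left h3 _

/-- If `C_φ` is compact on some weighted Bergman-Orlicz space, then the image measure of `v_α`
under `φ` is a vanishing Carleson measure. -/
lemma exists_vanishing_carleson_of_compositionCompact (hN : 1 ≤ N) [hα : Fact (-1 < α)]
    {φ : cBall N → cBall N} (hφ : HolomorphicOnBall fun z => (φ z : E)) {ψ : OrliczFunction}
    (hc : CompositionCompact α ψ φ) {ε : ℝ} (hε : 0 < ε) :
    ∃ η > 0, ∀ z : cBall N, 1 - ‖(z : E)‖ ^ 2 < η →
      (weightedVolume N α).map φ (bergmanRegion z)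
        ≤ ENNReal.ofReal ε * ENNReal.ofReal ((1 - ‖(z : E)‖ ^ 2) ^ (N + 1 + α)) := by
  have hφc := continuous_of_holomorphicOnBall hφ
  obtain ⟨T, hT, hTc⟩ := hc
  obtain ⟨m, C, hm, htest⟩ := BergmanOrlicz.exists_test_function (α := α) hN ψ
  by_contra! hcon
  choose a ha1 ha2 using fun k : ℕ => hcon (1 / ((k : ℝ) + 1)) (by positivity)
  choose M hM0 hM g hgC hg using fun k => htest (a k)
  have hδ : ∀ k, 0 < 1 - ‖(a k : E)‖ ^ 2 := fun k => one_sub_sq_pos (a k)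
  have hδlim : Tendsto (fun k => 1 - ‖(a k : E)‖ ^ 2) atTop (𝓝 0) :=
    squeeze_zero (fun k => (hδ k).le) (fun k => (ha1 k).le) tendsto_one_div_add_atTop_nhds_zero_nat
  have hn : 0 < N + 1 + α := by
    have := hα.out
    have : (0 : ℝ) ≤ N := N.cast_nonneg
    linarith
  -- the test functions tend to zero pointwise
  have hMle : ∀ k, M k * (1 - ‖(a k : E)‖ ^ 2) ^ m
      ≤ (1 / ψ 1 + 1) * (1 - ‖(a k : E)‖ ^ 2) := by
    intro k
    set δ := 1 - ‖(a k : E)‖ ^ 2 with hδk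
    have hδ0 := hδ k
    have hδ1 : δ ≤ 1 := by rw [hδk]; nlinarith [sq_nonneg ‖(a k : E)‖]
    -- Beyond 1, convexity gives `M ≤ ψ(M) / ψ(1)`; the summand 1 covers `M ≤ 1`. Since `m ≥ N + 2 +
    -- α`, multiplying by `δ ^ m` leaves at least one power of `δ`.
    have h1 : M k ≤ (1 / ψ 1 + 1) * δ ^ (-(N + 1 + α)) := by
      have h3 : 1 ≤ δ ^ (-(N + 1 + α)) :=
        Real.one_le_rpow_of_pos_of_le_one_of_nonpos hδ0 hδ1 (by linarith)
      have h4 := ψ.pos one_pos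
      have h5 : 0 ≤ 1 / ψ 1 * δ ^ (-(N + 1 + α)) := by positivity
      rcases le_total (M k) 1 with h | h
      · linarith
      · have h2 := ψ.le_scale h zero_le_one
        rw [mul_one, hM] at h2
        have : M k ≤ 1 / ψ 1 * δ ^ (-(N + 1 + α)) := by
          rw [one_div, le_inv_mul_iff₀ h4, mul_comm]
          exact h2
        linarith
    calc M k * δ ^ m ≤ (1 / ψ 1 + 1) * δ ^ (-(N + 1 + α)) * δ ^ m := by gcongr
      _ = (1 / ψ 1 + 1) * δ ^ (-(N + 1 + α) + m) := by
          rw [mul_assoc, ← Real.rpow_natCast δ m, ← Real.rpow_add hδ0]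
      _ ≤ (1 / ψ 1 + 1) * δ := by
          have := (ψ.pos one_pos).le
          gcongr
          calc δ ^ (-(N + 1 + α) + m) ≤ δ ^ (1 : ℝ) :=
                Real.rpow_le_rpow_of_exponent_ge hδ0 hδ1 (by linarith)
            _ = δ := Real.rpow_one δ
  have hpt : ∀ w : cBall N, Tendsto (fun k => g k w) atTop (𝓝 0) := by
    intro w
    rw [tendsto_zero_iff_norm_tendsto_zero]
    have hw : ‖(w : E)‖ < 1 := mem_ball_zero_iff.1 w.2
    set s := 1 - ‖(w : E)‖ with hs
    have hs0 : 0 < s := by linarith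
    have hlim := hδlim.const_mul ((1 / ψ 1 + 1) / (2 ^ m * s ^ m))
    rw [mul_zero] at hlim
    refine squeeze_zero (fun k => norm_nonneg _) (fun k => ?_) hlim
    have hak : ‖(a k : E)‖ < 1 := mem_ball_zero_iff.1 (a k).2
    have hq : s ≤ ‖1 - inner ℂ (a k : E) (w : E)‖ := by
      have h1 := norm_inner_le_norm (𝕜 := ℂ) (a k : E) (w : E)
      have h2 := norm_sub_norm_le (1 : ℂ) (inner ℂ (a k : E) (w : E))
      rw [norm_one] at h2
      nlinarith [norm_nonneg (w : E)]
    rw [hg]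
    have h0 := hM0 k
    have h1 := hδ k
    calc M k / 2 ^ m * ((1 - ‖(a k : E)‖ ^ 2) / ‖1 - inner ℂ (a k : E) (w : E)‖) ^ m
        ≤ M k / 2 ^ m * ((1 - ‖(a k : E)‖ ^ 2) / s) ^ m := by gcongr
      _ = M k * (1 - ‖(a k : E)‖ ^ 2) ^ m / (2 ^ m * s ^ m) := by
          rw [div_pow]; field_simp
      _ ≤ (1 / ψ 1 + 1) * (1 - ‖(a k : E)‖ ^ 2) / (2 ^ m * s ^ m) :=
          div_le_div_of_nonneg_right (hMle k) (by positivity)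
      _ = _ := by ring
  -- a subsequence of the images tends to zero in norm
  obtain ⟨G, -, θ, hθ, hlim⟩ := (hTc.isCompact_closure_image_closedBall (f := T.toLinearMap)
    C).tendsto_subseq (x := fun k => T (g k)) fun k => subset_closure
      ⟨g k, mem_closedBall_zero_iff.2 (hgC k), rfl⟩
  -- Norm convergence implies pointwise convergence, and the pointwise limit of `g k ∘ φ` is already
  -- known to be 0.
  have hG : G = 0 := by
    refine Subtype.ext (funext fun z => ?_)
    have h1 := BergmanOrlicz.tendsto_apply hN hlim z
    have h2 := (hpt (φ z)).comp hθ.tendsto_atTop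
    refine tendsto_nhds_unique h1 (h2.congr fun k => ?_)
    exact (hT (g (θ k)) z).symm
  rw [hG] at hlim
  -- `R` is chosen so that Chebyshev's inequality involves `ψ (A * M)`. Convexity bounds this below
  -- by `A * ψ M`, and `ε * A ≥ 1` then contradicts the choice of `a k`.
  set A := max 1 (1 / ε) with hA
  have hA1 : 1 ≤ A := le_max_left _ _
  have hA0 : 0 < A := by linarith
  set R := 1 / (8 ^ m * A) with hR
  have hR0 : 0 < R := by positivity
  have hlim' := hlim.norm
  rw [norm_zero] at hlim'
  obtain ⟨j, hj⟩ := (hlim'.eventually (gt_mem_nhds hR0)).exists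
  set k := θ j with hk
  have h1 := (T (g k)).orliczModular_le_one hj
  rw [show ((T (g k) : BergmanOrlicz N α ψ) : cBall N → ℂ) = fun z => g k (φ z) from
    funext (hT (g k))] at h1
  have h2 := ofReal_mul_map_bergmanRegion_le_one hφc (hM0 k) hR0 (hg k) h1
  have hRA : 1 / (8 ^ m * R) = A := by rw [hR]; field_simp
  rw [hRA] at h2
  refine absurd (ha2 k) (not_lt.2 ?_)
  set μ := (weightedVolume N α).map φ with hμ
  set δ := 1 - ‖(a k : E)‖ ^ 2 with hδk
  have h3 : 1 ≤ ε * A := by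
    calc 1 = ε * (1 / ε) := by field_simp
      _ ≤ ε * A := by gcongr; exact le_max_right _ _
  have hδ0 : 0 < δ := hδ k
  calc μ (bergmanRegion (a k))
      = 1 * μ (bergmanRegion (a k)) := (one_mul _).symm
    _ ≤ ENNReal.ofReal (ε * δ ^ (N + 1 + α) * ψ (A * M k)) * μ (bergmanRegion (a k)) := by
        refine mul_le_mul_left ?_ _
        rw [ENNReal.one_le_ofReal]
        have h4 := ψ.le_scale hA1 (hM0 k)
        rw [hM k] at h4
        calc 1 ≤ ε * A := h3
          _ = ε * δ ^ (N + 1 + α) * (A * δ ^ (-(N + 1 + α))) := by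
            rw [Real.rpow_neg hδ0.le]
            have : δ ^ (N + 1 + α) ≠ 0 := (Real.rpow_pos_of_pos hδ0 _).ne'
            field_simp
          _ ≤ _ := by gcongr
    _ = ENNReal.ofReal ε * ENNReal.ofReal (δ ^ (N + 1 + α)) *
        (ENNReal.ofReal (ψ (A * M k)) * μ (bergmanRegion (a k))) := by
        rw [ENNReal.ofReal_mul (by positivity), ENNReal.ofReal_mul hε.le]
        ring
    _ ≤ _ := mul_le_of_le_one_right' h2

end Composition

/-! ### Schwarz estimates and Montel's theorem -/

section Montel

variable {V : Type*} [NormedAddCommGroup V] [NormedSpace ℂ V]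

/-- The Schwarz lemma, as `F` maps the ball into the ball of radius `2 * X` about `F w`. It supplies
the equicontinuity in Montel's theorem. -/
lemma norm_sub_le_of_norm_le_of_differentiableOn {F : V → ℂ} {w z : V} {r X : ℝ}
    (hF : DifferentiableOn ℂ F (Metric.ball w r))
    (hX : ∀ z ∈ Metric.ball w r, ‖F z‖ ≤ X) (hz : z ∈ Metric.ball w r) :
    ‖F z - F w‖ ≤ 2 * X / r * ‖z - w‖ := by
  have hr : 0 < r := Metric.nonempty_ball.1 ⟨z, hz⟩
  have hmaps : MapsTo F (Metric.ball w r) (Metric.closedBall (F w) (2 * X)) := by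
    intro x hx
    rw [mem_closedBall_iff_norm]
    have := norm_sub_le (F x) (F w)
    have := hX x hx
    have := hX w (Metric.mem_ball_self hr)
    linarith
  have h := Complex.dist_le_div_mul_dist_of_mapsTo_ball hF hmaps hz
  rwa [dist_eq_norm, dist_eq_norm] at h

lemma norm_fderiv_le_of_norm_le {F : V → ℂ} {w : V} {r X : ℝ} (hr : 0 < r)
    (hF : DifferentiableOn ℂ F (Metric.ball w r))
    (hX : ∀ z ∈ Metric.ball w r, ‖F z‖ ≤ X) : ‖fderiv ℂ F w‖ ≤ 2 * X / r := by
  have hmaps : MapsTo F (Metric.ball w r) (Metric.closedBall (F w) (2 * X)) := by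
    intro x hx
    rw [mem_closedBall_iff_norm]
    have := norm_sub_le (F x) (F w)
    have := hX x hx
    have := hX w (Metric.mem_ball_self hr)
    linarith
  exact Complex.norm_fderiv_le_div_of_mapsTo_ball hF hmaps hr

/-- A second order Schwarz estimate. -/
lemma norm_sub_sub_fderiv_le {F : V → ℂ} {w z : V} {r X : ℝ}
    (hF : DifferentiableOn ℂ F (Metric.ball w r))
    (hX : ∀ z ∈ Metric.ball w r, ‖F z‖ ≤ X) (hz : z ∈ Metric.ball w r) :
    ‖F z - F w - fderiv ℂ F w (z - w)‖ ≤ 4 * X / r ^ 2 * ‖z - w‖ ^ 2 := by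
  have hr : 0 < r := Metric.nonempty_ball.1 ⟨z, hz⟩
  have hd := norm_fderiv_le_of_norm_le hr hF hX
  have hX0 : 0 ≤ X := (norm_nonneg _).trans (hX w (Metric.mem_ball_self hr))
  set G : V → ℂ := fun x => F x - fderiv ℂ F w (x - w) with hG
  have hGw : G w = F w := by simp [hG]
  have hGd : DifferentiableOn ℂ G (Metric.ball w r) :=
    hF.sub ((fderiv ℂ F w).differentiable.comp (differentiable_id.sub_const w)).differentiableOn
  -- The increment of `F` and its linear part each contribute at most `2 * X`.
  have hmaps : MapsTo G (Metric.ball w r) (Metric.closedBall (G w) (4 * X)) := by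
    intro x hx
    rw [mem_closedBall_iff_norm, hGw]
    have h1 : ‖fderiv ℂ F w (x - w)‖ ≤ 2 * X / r * r := by
      refine ((fderiv ℂ F w).le_opNorm _).trans ?_
      gcongr
      exact (mem_ball_iff_norm.1 hx).le
    rw [div_mul_cancel₀ _ hr.ne'] at h1
    have h2 := norm_sub_le (F x - F w) (fderiv ℂ F w (x - w))
    have h3 := norm_sub_le (F x) (F w)
    have h4 := hX x hx
    have h5 := hX w (Metric.mem_ball_self hr)
    have h6 : G x - F w = F x - F w - fderiv ℂ F w (x - w) := by rw [hG]; ring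
    rw [h6]
    linarith
  -- Removing the differential makes `G - G w` vanish beyond first order, and the Schwarz lemma then
  -- gains a second power of the distance.
  have hlo : (fun x => G x - G w) =o[𝓝 w] fun x => ‖x - w‖ ^ 1 := by
    have h1 : HasFDerivAt F (fderiv ℂ F w) w :=
      ((hF w (Metric.mem_ball_self hr)).differentiableAt (Metric.ball_mem_nhds w hr)).hasFDerivAt
    have h2 := h1.isLittleO
    simp only [pow_one]
    refine (h2.norm_right).congr_left fun x => ?_
    rw [hGw, hG]; ring
  have h := Complex.dist_le_mul_div_pow_of_mapsTo_ball_of_isLittleO hGd hmaps hlo hz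
  rw [dist_eq_norm, dist_eq_norm, hGw] at h
  have h6 : G z - F w = F z - F w - fderiv ℂ F w (z - w) := by rw [hG]; ring
  rw [h6] at h
  refine h.trans (le_of_eq ?_)
  ring

/-- A pointwise limit of a locally bounded sequence of holomorphic functions is holomorphic. -/
lemma differentiableAt_of_tendsto_of_norm_le [FiniteDimensional ℂ V] {F : ℕ → V → ℂ} {f : V → ℂ}
    {w : V} {r X : ℝ} (hr : 0 < r) (hF : ∀ n, DifferentiableOn ℂ (F n) (Metric.ball w r))
    (hX : ∀ n, ∀ z ∈ Metric.ball w r, ‖F n z‖ ≤ X)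
    (hlim : ∀ z ∈ Metric.ball w r, Tendsto (fun n => F n z) atTop (𝓝 (f z))) :
    DifferentiableAt ℂ f w := by
  have : ProperSpace (V →L[ℂ] ℂ) := FiniteDimensional.proper ℂ _
  -- The differential of the limit is a subsequential limit of the differentials at `w`; the
  -- quadratic error bound, uniform in `n`, survives the passage to the limit.
  obtain ⟨L, -, θ, hθ, hL⟩ := (isCompact_closedBall (0 : V →L[ℂ] ℂ) (2 * X / r)).tendsto_subseq
    (x := fun n => fderiv ℂ (F n) w)
    fun n => mem_closedBall_zero_iff.2 (norm_fderiv_le_of_norm_le hr (hF n) (hX n))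
  have key : ∀ z ∈ Metric.ball w r, ‖f z - f w - L (z - w)‖ ≤ 4 * X / r ^ 2 * ‖z - w‖ ^ 2 := by
    intro z hz
    have h1 := (hlim z hz).comp hθ.tendsto_atTop
    have h2 := (hlim w (Metric.mem_ball_self hr)).comp hθ.tendsto_atTop
    have h3 : Tendsto (fun n => fderiv ℂ (F (θ n)) w (z - w)) atTop (𝓝 (L (z - w))) :=
      ((ContinuousLinearMap.apply ℂ ℂ (z - w)).continuous.tendsto L).comp hL
    exact le_of_tendsto ((h1.sub h2).sub h3).norm
      (Eventually.of_forall fun n => norm_sub_sub_fderiv_le (hF (θ n)) (hX (θ n)) hz)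
  refine (HasFDerivAt.of_isLittleO (f' := L) ?_).differentiableAt
  have hO : (fun z => f z - f w - L (z - w)) =O[𝓝 w] fun z => ‖z - w‖ ^ 2 := by
    refine Asymptotics.IsBigO.of_bound (4 * X / r ^ 2) ?_
    filter_upwards [Metric.ball_mem_nhds w hr] with z hz
    rw [norm_pow, norm_norm]
    exact key z hz
  refine hO.trans_isLittleO ?_
  exact Asymptotics.isLittleO_pow_sub_sub w one_lt_two

variable {N : ℕ}

local notation "E" => EuclideanSpace ℂ (Fin N)

lemma exists_ball_subset (w : cBall N) : ∃ r > 0, ∃ s > 0, ∀ z ∈ Metric.ball (w : E) r,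
    z ∈ cBall N ∧ s ≤ 1 - ‖z‖ ^ 2 := by
  have hw : ‖(w : E)‖ < 1 := mem_ball_zero_iff.1 w.2
  set t := 1 - ‖(w : E)‖ with ht
  have ht0 : 0 < t := by linarith
  refine ⟨t / 2, by positivity, t / 2, by positivity, fun z hz => ?_⟩
  have h1 : ‖z‖ < 1 - t / 2 := by
    have := norm_sub_norm_le z (w : E)
    have := mem_ball_iff_norm.1 hz
    linarith
  refine ⟨mem_ball_zero_iff.2 (by linarith), ?_⟩
  nlinarith [norm_nonneg z]

/-- Montel's theorem on the ball, with pointwise convergence. -/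
lemma exists_subseq_tendsto_of_locally_bounded {u : ℕ → cBall N → ℂ}
    (hu : ∀ n, HolomorphicOnBall (u n))
    (hb : ∀ s > 0, ∃ X, ∀ n, ∀ w : cBall N, s ≤ 1 - ‖(w : E)‖ ^ 2 → ‖u n w‖ ≤ X) :
    ∃ θ : ℕ → ℕ, StrictMono θ ∧ ∃ f : cBall N → ℂ, HolomorphicOnBall f ∧
      ∀ w, Tendsto (fun k => u (θ k) w) atTop (𝓝 (f w)) := by
  choose F hF hFu using hu
  have hloc : ∀ w : cBall N, ∃ r > 0, ∃ X, ∀ n, DifferentiableOn ℂ (F n) (Metric.ball (w : E) r) ∧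
      ∀ z ∈ Metric.ball (w : E) r, z ∈ cBall N ∧ ‖F n z‖ ≤ X := by
    intro w
    obtain ⟨r, hr, s, hs, h⟩ := exists_ball_subset w
    obtain ⟨X, hX⟩ := hb s hs
    refine ⟨r, hr, X, fun n => ⟨(hF n).mono fun z hz => (h z hz).1, fun z hz => ⟨(h z hz).1, ?_⟩⟩⟩
    have h1 := hX n ⟨z, (h z hz).1⟩ (h z hz).2
    rwa [← hFu] at h1
  have hne : Nonempty (cBall N) := ⟨⟨0, by simp⟩⟩
  set d := TopologicalSpace.denseSeq (cBall N)
  choose X hX using fun j => hb _ (one_sub_sq_pos (d j))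
  -- Compactness of a countable product of discs replaces the diagonal argument on the dense
  -- sequence.
  have hcomp : IsCompact (Set.pi univ fun j : ℕ => Metric.closedBall (0 : ℂ) (X j)) :=
    isCompact_univ_pi fun j => isCompact_closedBall _ _
  obtain ⟨x, -, θ, hθ, hx⟩ := hcomp.tendsto_subseq (x := fun n j => u n (d j))
    fun n j _ => mem_closedBall_zero_iff.2 (hX j n (d j) le_rfl)
  rw [tendsto_pi_nhds] at hx
  have hcau : ∀ w : cBall N, ∃ y, Tendsto (fun k => u (θ k) w) atTop (𝓝 y) := by
    intro w
    refine cauchySeq_tendsto_of_complete ?_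
    obtain ⟨r, hr, X, hloc⟩ := hloc w
    have hX0 : 0 ≤ X := (norm_nonneg _).trans ((hloc 0).2 w (Metric.mem_ball_self hr)).2
    rw [Metric.cauchySeq_iff']
    intro ε hε
    -- The `+ 1` keeps the denominator positive when `X = 0`.
    obtain ⟨j, hj⟩ := (TopologicalSpace.denseRange_denseSeq (cBall N)).exists_dist_lt w
      (show 0 < min r (ε / 3 / (2 * X / r + 1)) by positivity)
    have hjr : (d j : E) ∈ Metric.ball (w : E) r := by
      rw [Metric.mem_ball, dist_comm]
      exact hj.trans_le (min_le_left _ _)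
    have hL : 2 * X / r * ‖(d j : E) - (w : E)‖ < ε / 3 := by
      have h1 : ‖(d j : E) - (w : E)‖ < ε / 3 / (2 * X / r + 1) := by
        rw [← dist_eq_norm, dist_comm]
        exact hj.trans_le (min_le_right _ _)
      rw [lt_div_iff₀ (by positivity)] at h1
      nlinarith [norm_nonneg ((d j : E) - (w : E))]
    have hdist : ∀ n, dist (u n w) (u n (d j)) < ε / 3 := by
      intro n
      have h1 := norm_sub_le_of_norm_le_of_differentiableOn (hloc n).1
        (fun z hz => ((hloc n).2 z hz).2) hjr
      rw [hFu, hFu] at h1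
      rw [dist_comm, dist_eq_norm]
      exact h1.trans_lt hL
    obtain ⟨n₀, hn₀⟩ := Metric.cauchySeq_iff'.1 (hx j).cauchySeq (ε / 3) (by positivity)
    refine ⟨n₀, fun n hn => ?_⟩
    have h1 : dist (u (θ n) (d j)) (u (θ n₀) (d j)) < ε / 3 := hn₀ n hn
    have h2 := hdist (θ n)
    have h3 := hdist (θ n₀)
    rw [dist_comm] at h3
    have h4 := dist_triangle4 (u (θ n) w) (u (θ n) (d j)) (u (θ n₀) (d j)) (u (θ n₀) w)
    linarith
  choose f hf using hcau
  classical
  refine ⟨θ, hθ, f, ⟨fun z => if h : z ∈ cBall N then f ⟨z, h⟩ else 0, ?_, fun z => ?_⟩, hf⟩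
  · intro w hw
    obtain ⟨r, hr, X, hloc⟩ := hloc ⟨w, hw⟩
    refine (differentiableAt_of_tendsto_of_norm_le (F := fun k => F (θ k)) hr
      (fun k => (hloc _).1) (fun k z hz => ((hloc _).2 z hz).2) fun z hz => ?_).differentiableWithinAt
    have hz1 := ((hloc 0).2 z hz).1
    rw [dif_pos hz1]
    refine (hf ⟨z, hz1⟩).congr fun k => ?_
    rw [← hFu]
  · exact dif_pos z.2

end Montel

/-! ### Compactness from vanishing Carleson measures -/

section Compactness

variable {N : ℕ} {α : ℝ}

local notation "E" => EuclideanSpace ℂ (Fin N)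

/-- The unit ball of `A^ψ_α` is sequentially compact for pointwise convergence. -/
lemma BergmanOrlicz.exists_subseq_tendsto (hN : 1 ≤ N) [hα : Fact (-1 < α)] {ψ : OrliczFunction}
    {f : ℕ → BergmanOrlicz N α ψ} (hf : ∀ n, ‖f n‖ ≤ 1) :
    ∃ θ : ℕ → ℕ, StrictMono θ ∧ ∃ g : BergmanOrlicz N α ψ, ‖g‖ ≤ 1 ∧
      ∀ w, Tendsto (fun k => f (θ k) w) atTop (𝓝 (g w)) := by
  obtain ⟨θ, hθ, g, hg, hlim⟩ := exists_subseq_tendsto_of_locally_bounded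
    (u := fun n => f n) (fun n => (f n).2.1) fun s hs => by
      obtain ⟨X, hX, h⟩ := exists_norm_apply_le (α := α) hN ψ hs
      exact ⟨X, fun n w hw => (h w hw (f n)).trans (mul_le_of_le_one_right hX (hf n))⟩
  -- Fatou's lemma for each `R > 1`: a norm at most 1 bounds the modular directly at scales strictly
  -- larger than 1.
  have hmod : ∀ R, 1 < R → orliczModular ψ (weightedVolume N α) g R ≤ 1 := by
    intro R hR
    have hR0 : 0 < R := by linarith
    have hc : Continuous fun x : ℂ => ψ (‖x‖ / R) :=
      ψ.continuousOn.comp_continuous (by fun_prop) fun x => div_nonneg (norm_nonneg _) hR0.le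
    have hpt : ∀ w, ENNReal.ofReal (ψ (‖g w‖ / R))
        = liminf (fun k => ENNReal.ofReal (ψ (‖f (θ k) w‖ / R))) atTop := fun w =>
      (Tendsto.liminf_eq
        (((ENNReal.continuous_ofReal.comp hc).tendsto (g w)).comp (hlim w))).symm
    unfold orliczModular
    rw [lintegral_congr hpt]
    refine (lintegral_liminf_le fun k =>
      (hc.comp (f (θ k)).2.1.continuous).measurable.ennreal_ofReal).trans ?_
    refine liminf_le_of_frequently_le' (Frequently.of_forall fun k => ?_)
    exact (f (θ k)).orliczModular_le_one ((hf _).trans_lt hR)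
  refine ⟨θ, hθ, ⟨g, hg, hg.continuous.aestronglyMeasurable, 2, two_pos,
    (hmod 2 one_lt_two).trans_lt ENNReal.one_lt_top⟩, ?_, hlim⟩
  refine le_of_forall_gt_imp_ge_of_dense fun R hR => ?_
  exact csInf_le luxemburg_bddBelow ⟨by linarith, hmod R hR⟩

/-- Pointwise convergence to zero of a bounded sequence implies norm convergence after composition
with `φ`, when the image measure under `φ` is a vanishing Carleson measure. -/
lemma eventually_orliczModular_comp_le_one (hN : 1 ≤ N) [hα : Fact (-1 < α)]
    {φ : cBall N → cBall N} (hφ : Continuous φ) {ν : OrliczFunction} (hν : ν.DeltaTwo)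
    (hvan : ∀ ε > 0, ∃ η > 0, ∀ z : cBall N, 1 - ‖(z : E)‖ ^ 2 < η →
      (weightedVolume N α).map φ (bergmanRegion z)
        ≤ ENNReal.ofReal ε * ENNReal.ofReal ((1 - ‖(z : E)‖ ^ 2) ^ (N + 1 + α)))
    {h : ℕ → BergmanOrlicz N α ν} {B : ℝ} (hB : ∀ k, ‖h k‖ < B)
    (hlim : ∀ w, Tendsto (fun k => h k w) atTop (𝓝 0)) {R : ℝ} (hR : 0 < R) :
    ∀ᶠ k in atTop, orliczModular ν (weightedVolume N α) (fun z => h k (φ z)) R ≤ 1 := by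
  have := isFiniteMeasure_weightedVolume hN hα.out
  set v := weightedVolume N α with hv
  set μ := v.map φ with hμ
  have hfin : IsFiniteMeasure μ := inferInstance
  have hB0 : 0 < B := (norm_nonneg _).trans_lt (hB 0)
  obtain ⟨C, hC, hcar⟩ := exists_orliczModular_le_of_carleson hN hα.out
  -- The modulars are at most 1 at scale `B`; `Δ₂` carries a uniform bound down to the scale `R`.
  obtain ⟨K, hK, L, hL, hKL⟩ := hν.exists_le_mul_add (t := R / B) (by positivity)
  set D := ENNReal.ofReal K + ENNReal.ofReal L * v univ with hD
  have hDt : D ≠ ∞ := ENNReal.add_ne_top.2 ⟨ENNReal.ofReal_ne_top,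
      ENNReal.mul_ne_top ENNReal.ofReal_ne_top (measure_ne_top _ _)⟩
  have hmod : ∀ k, orliczModular ν v (h k) R ≤ D := by
    intro k
    have h1 : orliczModular ν v (h k) R ≤ ∫⁻ z, (ENNReal.ofReal K * ENNReal.ofReal
        (ν (‖h k z‖ / B)) + ENNReal.ofReal L) ∂v := by
      refine lintegral_mono fun z => ?_
      rw [← ENNReal.ofReal_mul hK, ← ENNReal.ofReal_add
        (mul_nonneg hK (ν.nonneg' _ (by positivity))) hL]
      refine ENNReal.ofReal_le_ofReal ((hKL _ (by positivity)).trans (le_of_eq ?_))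
      rw [show R / B * (‖h k z‖ / R) = ‖h k z‖ / B by field_simp]
    rw [lintegral_add_right _ measurable_const, lintegral_const_mul' _ _ ENNReal.ofReal_ne_top,
      lintegral_const] at h1
    refine h1.trans (add_le_add_left (mul_le_of_le_one_right' ?_) _)
    exact (h k).orliczModular_le_one (hB k)
  obtain ⟨ε, hε, hεD⟩ : ∃ ε : ℝ, 0 < ε ∧ C * ENNReal.ofReal ε * D ≤ 1 / 2 := by
    set c := (C * D).toReal with hc
    have hCD : C * D = ENNReal.ofReal c := (ENNReal.ofReal_toReal (ENNReal.mul_ne_top hC hDt)).symm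
    have hc0 : 0 ≤ c := ENNReal.toReal_nonneg
    refine ⟨1 / (2 * (c + 1)), by positivity, ?_⟩
    rw [mul_right_comm, hCD, ← ENNReal.ofReal_mul hc0]
    have h2 : (1 / 2 : ℝ≥0∞) = ENNReal.ofReal (1 / 2) := by
      rw [ENNReal.ofReal_div_of_pos two_pos]; simp
    rw [h2]
    refine ENNReal.ofReal_le_ofReal ?_
    rw [mul_one_div, div_le_div_iff₀ (by positivity) two_pos]
    linarith
  obtain ⟨η, hη, hηz⟩ := hvan ε hε
  -- If `bergmanRegion z` meets `A`, then `1 - |z|² < η`. Hence `μ.restrict A` is Carleson with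
  -- constant `ε` for all `z`, not only those near the sphere.
  set A : Set (cBall N) := {w | 1 - ‖(w : E)‖ ^ 2 < η / 2} with hA
  have hAm : MeasurableSet A := by
    have h1 : Continuous fun w : cBall N => 1 - ‖(w : E)‖ ^ 2 := by fun_prop
    exact (isOpen_lt h1 continuous_const).measurableSet
  have hnear : ∀ k, orliczModular ν (μ.restrict A) (h k) R ≤ 1 / 2 := by
    intro k
    refine (hcar (μ.restrict A) (ENNReal.ofReal ε) (fun z => ?_) ν (h k) (h k).2.1 R hR).trans
      ((mul_le_mul_right (hmod k) _).trans hεD)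
    rcases lt_or_ge (1 - ‖(z : E)‖ ^ 2) η with hz | hz
    · exact (Measure.restrict_apply_le _ _).trans (hηz z hz)
    · rw [Measure.restrict_apply (measurableSet_bergmanRegion z)]
      have : bergmanRegion z ∩ A = ∅ := by
        refine eq_empty_of_forall_notMem fun w hw => ?_
        have h1 := hw.1.2
        have h2 : 1 - ‖(w : E)‖ ^ 2 < η / 2 := hw.2
        linarith
      simp [this]
  -- Off `A` point evaluations are uniformly bounded, so a constant dominates on this finite
  -- measure.
  have hfar : Tendsto (fun k => orliczModular ν (μ.restrict Aᶜ) (h k) R) atTop (𝓝 0) := by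
    obtain ⟨X, hX, hXle⟩ := BergmanOrlicz.exists_norm_apply_le (α := α) hN ν (half_pos hη)
    have hc : Continuous fun x : ℂ => ν (‖x‖ / R) :=
      ν.continuousOn.comp_continuous (by fun_prop) fun x => div_nonneg (norm_nonneg _) hR.le
    have h1 := tendsto_lintegral_of_dominated_convergence (μ := μ.restrict Aᶜ)
      (F := fun k z => ENNReal.ofReal (ν (‖h k z‖ / R))) (f := fun _ => 0)
      (fun _ => ENNReal.ofReal (ν (X * B / R)))
      (fun k => (hc.comp (h k).2.1.continuous).measurable.ennreal_ofReal)
      (fun k => by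
        filter_upwards [ae_restrict_mem hAm.compl] with w hw
        refine ENNReal.ofReal_le_ofReal (ν.monotoneOn (mem_Ici.2 (by positivity))
          (mem_Ici.2 (by positivity)) ?_)
        have h2 := hXle w (not_lt.1 hw) (h k)
        have h3 := (hB k).le
        gcongr
        exact h2.trans (by gcongr))
      (by
        rw [lintegral_const]
        exact ENNReal.mul_ne_top ENNReal.ofReal_ne_top (measure_ne_top _ _))
      (ae_of_all _ fun w => by
        have h2 := ((ENNReal.continuous_ofReal.comp hc).tendsto 0).comp (hlim w)
        simpa [ν.map_zero', Function.comp_def] using h2)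
    rwa [lintegral_zero] at h1
  have hhalf : (0 : ℝ≥0∞) < 1 / 2 := by simp
  filter_upwards [hfar.eventually (gt_mem_nhds hhalf)] with k hk
  rw [← orliczModular_map (h k).2.1.continuous hφ hR.le]
  have h1 : orliczModular ν μ (h k) R = orliczModular ν (μ.restrict A) (h k) R
      + orliczModular ν (μ.restrict Aᶜ) (h k) R := (lintegral_add_compl _ hAm).symm
  calc orliczModular ν μ (h k) R ≤ 1 / 2 + 1 / 2 := h1.le.trans (add_le_add (hnear k) hk.le)
    _ = 1 := ENNReal.add_halves 1

/-- If the image measure of `v_α` under `φ` is a vanishing Carleson measure, then `C_φ` is compact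
on all weighted Bergman-Orlicz spaces defined by functions satisfying the `Δ₂`-condition. -/
lemma compositionCompact_of_vanishing_carleson (hN : 1 ≤ N) [hα : Fact (-1 < α)]
    {φ : cBall N → cBall N} (hφ : HolomorphicOnBall fun z => (φ z : E)) {ν : OrliczFunction}
    (hν : ν.DeltaTwo)
    (hvan : ∀ ε > 0, ∃ η > 0, ∀ z : cBall N, 1 - ‖(z : E)‖ ^ 2 < η →
      (weightedVolume N α).map φ (bergmanRegion z)
        ≤ ENNReal.ofReal ε * ENNReal.ofReal ((1 - ‖(z : E)‖ ^ 2) ^ (N + 1 + α))) :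
    CompositionCompact α ν φ := by
  have hφc := continuous_of_holomorphicOnBall hφ
  have := isFiniteMeasure_weightedVolume hN hα.out
  have hfin : IsFiniteMeasure ((weightedVolume N α).map φ) := inferInstance
  set μ := (weightedVolume N α).map φ with hμ
  have hn : 0 < N + 1 + α := by
    have := hα.out
    have : (0 : ℝ) ≤ N := N.cast_nonneg
    linarith
  -- A vanishing Carleson measure is Carleson: where `1 - |z|² ≥ η` the total mass is a sufficient
  -- bound.
  obtain ⟨T, hT⟩ : CompositionBounded α ν φ := by
    obtain ⟨η, hη, h⟩ := hvan 1 one_pos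
    refine compositionBounded_of_carleson hN hφ
      (κ := 1 + μ univ * ENNReal.ofReal (η ^ (-(N + 1 + α)))) ?_ (fun z => ?_) ν
    · exact ENNReal.add_ne_top.2 ⟨ENNReal.one_ne_top,
        ENNReal.mul_ne_top (measure_ne_top _ _) ENNReal.ofReal_ne_top⟩
    · rw [add_mul]
      rcases lt_or_ge (1 - ‖(z : E)‖ ^ 2) η with hz | hz
      · refine (h z hz).trans ?_
        rw [ENNReal.ofReal_one]
        exact le_self_add
      · refine le_trans ?_ le_add_self
        rw [mul_assoc, ← ENNReal.ofReal_mul (by positivity)]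
        refine (measure_mono (subset_univ _)).trans (le_mul_of_one_le_right' ?_)
        rw [ENNReal.one_le_ofReal]
        calc (1 : ℝ) = η ^ (-(N + 1 + α)) * η ^ (N + 1 + α) := by
              rw [← Real.rpow_add hη, neg_add_cancel, Real.rpow_zero]
          _ ≤ _ := by gcongr
  refine ⟨T, hT, ?_⟩
  -- The image of the closed unit ball is itself sequentially compact, because pointwise limits of
  -- its elements stay in that ball.
  refine (isCompactOperator_iff_image_closedBall_subset_compact T.toLinearMap one_pos).2
    ⟨_, IsSeqCompact.isCompact ?_, Subset.rfl⟩
  intro x hx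
  choose f hf hfx using hx
  obtain ⟨θ, hθ, g, hg, hlim⟩ := BergmanOrlicz.exists_subseq_tendsto hN
    fun n => mem_closedBall_zero_iff.1 (hf n)
  refine ⟨T g, ⟨g, mem_closedBall_zero_iff.2 hg, rfl⟩, θ, hθ, ?_⟩
  rw [tendsto_iff_norm_sub_tendsto_zero, Metric.tendsto_atTop']
  intro ε hε
  have hB : ∀ k, ‖f (θ k) - g‖ < 3 := fun k => by
    have h1 := norm_sub_le (f (θ k)) g
    have h2 := mem_closedBall_zero_iff.1 (hf (θ k))
    linarith
  have hlim0 : ∀ w, Tendsto (fun k => (f (θ k) - g : BergmanOrlicz N α ν) w) atTop (𝓝 0) :=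
    fun w => by
      have h1 := (hlim w).sub_const (g w)
      rwa [sub_self] at h1
  obtain ⟨n₀, hn₀⟩ := eventually_atTop.1
    (eventually_orliczModular_comp_le_one hN hφc hν hvan hB hlim0 (half_pos hε))
  refine ⟨n₀, fun n hn => ?_⟩
  have h1 := hn₀ n hn.le
  have h2 : (x ∘ θ) n - T g = T (f (θ n) - g) := by
    rw [map_sub, Function.comp_apply, ← hfx]
    rfl
  rw [dist_zero_right, norm_norm, h2]
  refine lt_of_le_of_lt ?_ (half_lt_self hε)
  refine csInf_le luxemburg_bddBelow ⟨half_pos hε, ?_⟩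
  refine le_trans (le_of_eq ?_) h1
  congr 1
  exact funext (hT (f (θ n) - g))

end Compactness

/-! ### Conclusion -/

theorem corollary3p4 (N : ℕ) (hN : 1 ≤ N) (α : ℝ) [Fact (-1 < α)]
    (φ : cBall N → cBall N)
    (hφ : HolomorphicOnBall (fun z => (φ z : EuclideanSpace ℂ (Fin N))))
    (ψ : OrliczFunction) :
    (∀ ν : OrliczFunction, ν.DeltaTwo →
      (CompositionBounded α ν φ → CompositionBounded α ψ φ) ∧
      (ψ.NablaZero → CompositionCompact α ψ φ → CompositionCompact α ν φ)) ∧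
    (∀ (p : ℝ) (hp : 1 < p),
      (CompositionBounded α (OrliczFunction.power p hp) φ → CompositionBounded α ψ φ) ∧
      (ψ.NablaZero → CompositionCompact α ψ φ →
        CompositionCompact α (OrliczFunction.power p hp) φ)) := by
  have key : ∀ ν : OrliczFunction, ν.DeltaTwo →
      (CompositionBounded α ν φ → CompositionBounded α ψ φ) ∧
      (ψ.NablaZero → CompositionCompact α ψ φ → CompositionCompact α ν φ) := by
    refine fun ν hν => ⟨fun hb => ?_, fun _ hc => ?_⟩
    · obtain ⟨κ, hκ, h⟩ := exists_carleson_of_compositionBounded hN hφ hν hb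
      exact compositionBounded_of_carleson hN hφ hκ h ψ
    · exact compositionCompact_of_vanishing_carleson hN hφ hν fun ε hε =>
        exists_vanishing_carleson_of_compositionCompact hN hφ hc hε
  exact ⟨key, fun p hp => key _ (OrliczFunction.deltaTwo_power p hp)⟩
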